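/- Let $(\mathcal S,\mathcal A,\mathcal P,\mathcal R,\gamma)$ be a Markov decision process with finite state set $\mathcal S$, finite action set $\mathcal A$, transition probabilities $\mathcal P(s'\mid s,a)$, bounded (possibly random) rewards whose law depends on the transition $(s,a,s')$, and discount factor $\gamma\in[0,1)$. Let $\pi(a\mid s)$ be a stationary policy, let $(s_t,a_t,r_{t+1})_{t\ge 0}$ be a trajectory of the process under $\pi$ with arbitrary law of $(s_0,a_0)$, and let $(\mathcal F_t)$ be a filtration to which $(s_t,a_t,r_t)$ is adapted and with respect to which it has this Markovian dynamics, i.e. given $\mathcal F_t$ one has $s_{t+1}\sim\mathcal P(\cdot\mid s_t,a_t)$, $r_{t+1}$ is drawn from the reward law of $(s_t,a_t,s_{t+1})$, and $a_{t+1}\sim\pi(\cdot\mid s_{t+1})$. For $l\ge1$ and $q:\mathcal S\times\mathcal A\to\mathbb R$ define the $l$-step optimality operator $$(\mathbf H^l q)(s,a)=\sum_{y\in\mathcal S}p_l(y\mid s,a)\Big[\bar r_l(s,a)+\gamma^l\max_{b\in\mathcal A}q(y,b)\Big],$$ where $p_l(y\mid s,a)$ is the probability of being in state $y$ after $l$ steps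 when starting with the state-action pair $(s,a)$ and choosing all later actions by $\pi$, and $\bar r_l(s,a)$ is the corresponding expected accumulated reward $\mathbb E\big[\sum_{i=1}^l\gamma^{i-1}r_i\mid s,a\big]$. Let $L\ge 1$. Starting from an arbitrary $Q_0$, let $$Q_{t+1}(s_t,a_t)=Q_t(s_t,a_t)+\alpha_t\,\frac1L\sum_{l=1}^L\Big(\sum_{i=1}^l\gamma^{i-1}r_{t+i}+\gamma^l\max_{b\in\mathcal A}Q_t(s_{t+l},b)-Q_t(s_t,a_t)\Big),$$ and $Q_{t+1}(s,a)=Q_t(s,a)$ for $(s,a)\ne(s_t,a_t)$. Suppose that the step sizes $\alpha_t\in[0,1]$ are $\mathcal F_t$-measurable (for instance deterministic), that almost surely $\sum_t\alpha_t^2<\infty$, and that almost surely, for every pair $(s,a)$, $\sum_{t:\,(s_t,a_t)=(s,a)}\alpha_t=\infty$. Then the averaged operator $\frac1L\sum_{l=1}^L\mathbf H^l$ has exactly one fixed point $Q^f$, and with probability $1$, $Q_t(s,a)\to Q^f(s,a)$ for all $(s,a)\in\mathcal S\times\mathcal A$. In particular, if some $q$ satisfies $\mathbf H^l q=q$ for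 all $l=1,\dots,L$, then $q=Q^f$. -/

import Mathlib

open MeasureTheory Filter Topology

namespace MSTD

/-- A finite Markov decision process `(S, A, P, R, γ)`. When action `a` is taken in state `s`, the
next state is `s'` with probability `P s a s'`, and, given the transition `(s, a, s')`, the reward
has the law `rewardLaw s a s'` on `ℝ`. -/
structure MDP (S A : Type*) where
  /-- transition probabilities -/
  P : S → A → PMF S
  /-- law of the reward received on the transition from `s` to `s'` under `a` -/
  rewardLaw : S → A → S → ProbabilityMeasure ℝ
  /-- discount factor -/
  γ : ℝ

section Operators

variable {S A : Type*}

/-- The rewards of the MDP are bounded. -/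
def MDP.BoundedRewards (M : MDP S A) : Prop :=
  ∃ C : ℝ, ∀ s a s', ∀ᵐ x ∂(M.rewardLaw s a s' : Measure ℝ), |x| ≤ C

/-- Expected one-step reward of the state-action pair `(s, a)`. -/
noncomputable def MDP.meanReward [Fintype S] (M : MDP S A) (s : S) (a : A) : ℝ :=
  ∑ s' : S, (M.P s a s').toReal * ∫ x, x ∂(M.rewardLaw s a s' : Measure ℝ)

/-- Transition matrix of the chain of state-action pairs under the stationary policy `π`:
from `(s, a)` move to `s'` with probability `P(s' | s, a)`, then choose `a'` with
probability `π(a' | s')`. -/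
noncomputable def MDP.pairMatrix (M : MDP S A) (π : S → PMF A) : Matrix (S × A) (S × A) ℝ :=
  fun x x' => (M.P x.1 x.2 x'.1).toReal * (π x'.1 x'.2).toReal

variable [Fintype S] [Fintype A] [DecidableEq S] [DecidableEq A]

/-- `p_l(y | s, a)`: probability of being in state `y` after `l` steps, starting from the
state-action pair `(s, a)` and choosing all later actions by `π`. -/
noncomputable def MDP.stepProb (M : MDP S A) (π : S → PMF A) (l : ℕ) (y : S) (s : S) (a : A) : ℝ :=
  ∑ b : A, (M.pairMatrix π ^ l) (s, a) (y, b)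

/-- Expected accumulated reward `𝔼[∑_{i=1}^l γ^{i-1} r_i | s, a]` over `l` steps, starting from the
state-action pair `(s, a)` and choosing all later actions by `π`. -/
noncomputable def MDP.accReward (M : MDP S A) (π : S → PMF A) (l : ℕ) (s : S) (a : A) : ℝ :=
  ∑ i ∈ Finset.Icc 1 l, M.γ ^ (i - 1) *
    ∑ x : S × A, (M.pairMatrix π ^ (i - 1)) (s, a) x * M.meanReward x.1 x.2

/-- `max_b q(y, b)`. -/
noncomputable def maxQ {S A : Type*} [Fintype A] [Nonempty A] (q : S → A → ℝ) (y : S) : ℝ :=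
  Finset.univ.sup' Finset.univ_nonempty (q y)

/-- The `l`-step optimality operator
`(H^l q)(s, a) = ∑_y p_l(y | s, a) [r̄_l + γ^l max_b q(y, b)]`. -/
noncomputable def MDP.H [Nonempty A] (M : MDP S A) (π : S → PMF A) (l : ℕ)
    (q : S → A → ℝ) : S → A → ℝ :=
  fun s a => ∑ y : S, M.stepProb π l y s a * (M.accReward π l s a + M.γ ^ l * maxQ q y)

/-- The averaged operator `(1 / L) ∑_{l=1}^L H^l`. -/
noncomputable def MDP.avgH [Nonempty A] (M : MDP S A) (π : S → PMF A) (L : ℕ)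
    (q : S → A → ℝ) : S → A → ℝ :=
  fun s a => (1 / (L : ℝ)) * ∑ l ∈ Finset.Icc 1 L, M.H π l q s a

end Operators

/-- The multi-state TD error at time `t` of the Q-function `q` along the sequences of states `s`,
actions `a` and rewards `r`. -/
noncomputable def tdError {S A : Type*} [Fintype A] [Nonempty A] (γ : ℝ) (L : ℕ)
    (s : ℕ → S) (a : ℕ → A) (r : ℕ → ℝ) (q : S → A → ℝ) (t : ℕ) : ℝ :=
  (1 / (L : ℝ)) * ∑ l ∈ Finset.Icc 1 L,
    (∑ i ∈ Finset.Icc 1 l, γ ^ (i - 1) * r (t + i) + γ ^ l * maxQ q (s (t + l)) - q (s t) (a t))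

/-- `(s_t, a_t, r_t)` is a trajectory of the MDP `M` under the stationary policy `π`, with respect
to the filtration `ℱ`: the process is adapted, and, given the past `ℱ t`, the next state, reward
and action are drawn as `s_{t+1} ∼ P(· | s_t, a_t)`, `r_{t+1} ∼ rewardLaw s_t a_t s_{t+1}`,
`a_{t+1} ∼ π(· | s_{t+1})`. The law of `(s_0, a_0)` is arbitrary. -/
structure IsTrajectory {S A Ω : Type*} [MeasurableSpace S] [MeasurableSpace A]
    {mΩ : MeasurableSpace Ω} (M : MDP S A) (π : S → PMF A) (μ : Measure Ω) (ℱ : Filtration ℕ mΩ)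
    (s : ℕ → Ω → S) (a : ℕ → Ω → A) (r : ℕ → Ω → ℝ) : Prop where
  state_meas : ∀ t, Measurable[ℱ t] (s t)
  action_meas : ∀ t, Measurable[ℱ t] (a t)
  reward_meas : ∀ t, Measurable[ℱ t] (r t)
  markov : ∀ (t : ℕ) (s' : S) (a' : A) (B : Set ℝ), MeasurableSet B →
    μ[Set.indicator {ω | s (t + 1) ω = s' ∧ a (t + 1) ω = a' ∧ r (t + 1) ω ∈ B}
        (fun _ => (1 : ℝ)) | ℱ t]
      =ᵐ[μ] fun ω => (M.P (s t ω) (a t ω) s').toReal *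
        (M.rewardLaw (s t ω) (a t ω) s' : Measure ℝ).real B * (π s' a').toReal

end MSTD

namespace MSTD

/-! Write x_t = (s_t, a_t), and let w_t be the sampled target minus `avgH` of the current iterate at
x_t. `avgH` is a γ-contraction in the sup norm, so it has a unique fixed point Qf. Each entry z is
relaxed towards the target with step size c_t = α_t 1{x_t = z}. If Σ c_t w_t converges, the averaged
noise W_{t+1} = (1 - c_t) W_t + c_t w_t tends to 0 (`tendsto_zero_of_averaging`), and Q - Qf - W
obeys an asynchronous contraction with vanishing perturbation, so it tends to 0
(`tendsto_zero_of_asynchronous_contraction`).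

Two obstacles stand in the way of the convergence of Σ c_t w_t. The target at time t looks up to L
steps ahead, so even from a deterministic start Q_t is only known to be ℱ (t + L)-measurable, and
w_t need not be centred given ℱ t. Replacing Q_t by Q_{t-L} restores measurability at the cost of an
error O(α_t Σ_{1≤j≤L} α_{t-j}), which is summable because Σ α_t² is. With the lagged iterate, the
l-step noise telescopes into one-step martingale differences with predictable, square-summable
coefficients, and `ae_tendsto_martingale_transform` applies.

Also, Q_0 may depend on ω in any way. The noise is therefore estimated only for the iteration
started at 0, which is measurable and bounded by R / (1 - γ), with R a bound on the rewards; two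
iterations driven by the same samples merge by contraction (`tendsto_sub`). -/

/-! ### Deterministic relaxation recursions -/

theorem eventually_le_of_relaxation {u a : ℕ → ℝ} {b δ : ℝ} {T : ℕ}
    (ha : ∀ t, a t ∈ Set.Icc (0 : ℝ) 1)
    (hsum : Tendsto (fun n => ∑ t ∈ Finset.range n, a t) atTop atTop)
    (h : ∀ t ≥ T, u (t + 1) ≤ (1 - a t) * u t + a t * b) (hδ : 0 < δ) :
    ∀ᶠ t in atTop, u t ≤ b + δ := by
  set A : ℕ → ℝ := fun n => ∑ t ∈ Finset.range n, a t with hA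
  -- Since 1 - a ≤ exp(-a), the product of the factors 1 - a t is at most the exponential of minus a
  -- divergent sum.
  have key : ∀ n ≥ T, u n - b ≤ Real.exp (A T - A n) * |u T - b| := by
    intro n hn
    induction n, hn using Nat.le_induction with
    | base => simpa using le_abs_self (u T - b)
    | succ n hn ih =>
      have h1 : u (n + 1) - b ≤ (1 - a n) * (u n - b) := by linarith [h n hn]
      have h2 : (1 - a n) * (u n - b) ≤ (1 - a n) * (Real.exp (A T - A n) * |u T - b|) :=
        mul_le_mul_of_nonneg_left ih (by linarith [(ha n).2])
      have h3 : (1 - a n) ≤ Real.exp (-a n) := by linarith [Real.add_one_le_exp (-a n)]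
      have h4 : Real.exp (A T - A (n + 1)) = Real.exp (-a n) * Real.exp (A T - A n) := by
        rw [← Real.exp_add]
        congr 1
        simp only [hA, Finset.sum_range_succ]
        ring
      rw [h4, mul_assoc]
      exact h1.trans (h2.trans (mul_le_mul_of_nonneg_right h3 (by positivity)))
  have hlim : Tendsto (fun n => Real.exp (A T - A n) * |u T - b|) atTop (𝓝 0) := by
    have h1 : Tendsto (fun n => A T - A n) atTop atBot :=
      tendsto_atBot_add_const_left _ _ (tendsto_neg_atTop_atBot.comp hsum)
    simpa using (Real.tendsto_exp_atBot.comp h1).mul_const |u T - b|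
  filter_upwards [hlim.eventually (gt_mem_nhds hδ), eventually_ge_atTop T] with n h1 h2
  linarith [key n h2]

/-- A uniform bound D on all entries eventually improves to γ D up to an arbitrarily small error,
since every entry has divergent total step size; iterating this gives γ^k B for every k. Quantifying
over D in `h` takes the place of a sup norm. -/
theorem tendsto_zero_of_asynchronous_contraction {X : Type*} [Finite X] {y a : ℕ → X → ℝ}
    {ε : ℕ → ℝ} {γ : ℝ} (hγ0 : 0 ≤ γ) (hγ1 : γ < 1)
    (ha : ∀ t x, a t x ∈ Set.Icc (0 : ℝ) 1)
    (hsum : ∀ x, Tendsto (fun n => ∑ t ∈ Finset.range n, a t x) atTop atTop)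
    (hy : ∀ t x, 0 ≤ y t x) (hε : Tendsto ε atTop (𝓝 0))
    (h : ∀ t x D, (∀ x', y t x' ≤ D) →
      y (t + 1) x ≤ (1 - a t x) * y t x + a t x * (γ * D + ε t)) (x : X) :
    Tendsto (fun t => y t x) atTop (𝓝 0) := by
  have hX : Nonempty X := ⟨x⟩
  obtain ⟨E, hE⟩ := hε.bddAbove_range
  replace hE : ∀ t, ε t ≤ E := fun t => hE ⟨t, rfl⟩
  obtain ⟨B₀, hB₀⟩ := (Set.finite_range (y 0)).bddAbove
  replace hB₀ : ∀ x, y 0 x ≤ B₀ := fun x => hB₀ ⟨x, rfl⟩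
  -- Large enough to dominate the initial values and to be preserved by D ↦ γ D + E.
  set B := max B₀ (E / (1 - γ)) with hBdef
  have hBE : γ * B + E ≤ B := by
    have : E / (1 - γ) ≤ B := le_max_right _ _
    rw [div_le_iff₀ (by linarith)] at this
    linarith
  have hB : ∀ t x, y t x ≤ B := by
    intro t
    induction t with
    | zero => exact fun x => (hB₀ x).trans (le_max_left _ _)
    | succ t ih =>
      intro x
      have h1 := h t x B ih
      have h2 : (1 - a t x) * y t x ≤ (1 - a t x) * B :=
        mul_le_mul_of_nonneg_left (ih x) (by linarith [(ha t x).2])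
      have h3 : a t x * (γ * B + ε t) ≤ a t x * B :=
        mul_le_mul_of_nonneg_left (by linarith [hE t]) (ha t x).1
      linarith
  have step : ∀ η > 0, ∀ k : ℕ, ∀ᶠ t in atTop, ∀ x, y t x ≤ γ ^ k * B + η := by
    intro η hη k
    induction k with
    | zero => exact Eventually.of_forall fun t x => by linarith [hB t x, one_mul B, pow_zero γ]
    | succ k ih =>
      rw [eventually_all]
      intro x
      have hδ : 0 < (1 - γ) * η / 2 := by
        have : 0 < 1 - γ := by linarith
        positivity
      obtain ⟨T, hT⟩ := eventually_atTop.1 (ih.and (hε.eventually (gt_mem_nhds hδ)))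
      -- Passing from η to γ η leaves a slack of (1 - γ) η: half absorbs ε, half is the δ of the
      -- relaxation lemma.
      have h1 := eventually_le_of_relaxation (u := fun t => y t x) (a := fun t => a t x)
        (b := γ * (γ ^ k * B + η) + (1 - γ) * η / 2) (T := T) (fun t => ha t x) (hsum x)
        (fun t ht => (h t x _ (hT t ht).1).trans (by
          have := mul_le_mul_of_nonneg_left (hT t ht).2.le (ha t x).1
          linarith)) hδ
      filter_upwards [h1] with t ht
      refine ht.trans (le_of_eq ?_)
      ring
  rw [Metric.tendsto_atTop']
  intro δ hδ
  have h0 : Tendsto (fun k : ℕ => γ ^ k * B) atTop (𝓝 0) := by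
    simpa using (tendsto_pow_atTop_nhds_zero_of_lt_one hγ0 hγ1).mul_const B
  obtain ⟨k, hk⟩ := (h0.eventually (gt_mem_nhds (half_pos hδ))).exists
  obtain ⟨T, hT⟩ := eventually_atTop.1 (step (δ / 2) (half_pos hδ) k)
  refine ⟨T, fun n hn => ?_⟩
  rw [Real.dist_eq, sub_zero, abs_of_nonneg (hy n x)]
  linarith [hT n hn.le x]

/-- With R the partial sum of a w minus its limit, the noise cancels in W - R, which is relaxed
towards -R → 0. This is the contraction lemma with γ = 0 and a single entry. -/
theorem tendsto_zero_of_averaging {W a w : ℕ → ℝ} (ha : ∀ t, a t ∈ Set.Icc (0 : ℝ) 1)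
    (hsum : Tendsto (fun n => ∑ t ∈ Finset.range n, a t) atTop atTop)
    (hW : ∀ t, W (t + 1) = (1 - a t) * W t + a t * w t)
    (hw : ∃ l, Tendsto (fun n => ∑ t ∈ Finset.range n, a t * w t) atTop (𝓝 l)) :
    Tendsto W atTop (𝓝 0) := by
  obtain ⟨l, hl⟩ := hw
  set R : ℕ → ℝ := fun n => ∑ t ∈ Finset.range n, a t * w t - l with hR
  have hR0 : Tendsto R atTop (𝓝 0) := by simpa [hR] using hl.sub_const l
  have hU := tendsto_zero_of_asynchronous_contraction (X := Unit) (y := fun t _ => |W t - R t|)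
    (a := fun t _ => a t) (ε := fun t => |R t|) (γ := 0) le_rfl one_pos (fun t _ => ha t)
    (fun _ => hsum) (fun _ _ => abs_nonneg _) (by simpa using hR0.abs) (by
      intro t _ D _
      have : W (t + 1) - R (t + 1) = (1 - a t) * (W t - R t) + a t * (-R t) := by
        rw [hW]
        simp only [hR, Finset.sum_range_succ]
        ring
      rw [this]
      refine (abs_add_le _ _).trans (le_of_eq ?_)
      rw [abs_mul, abs_mul, abs_neg, abs_of_nonneg (ha t).1,
        abs_of_nonneg (sub_nonneg.2 (ha t).2)]
      ring) ()
  simpa using ((tendsto_zero_iff_abs_tendsto_zero _).2 hU).add hR0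

/-! ### Convergence of martingale transforms -/

section MartingaleTransform

variable {Ω : Type*} {mΩ : MeasurableSpace Ω} {μ : Measure Ω} [IsProbabilityMeasure μ]
  {𝒢 : Filtration ℕ mΩ} {c d : ℕ → Ω → ℝ} {C : ℝ}

/-- Orthogonality of increments gives E M_n² ≤ C² N; the martingale is then bounded in L¹ and
converges almost surely. -/
theorem ae_tendsto_martingale_transform_of_bounded {N : ℝ}
    (hc : ∀ n, Measurable[𝒢 n] (c n)) (hd : ∀ n, Measurable[𝒢 (n + 1)] (d n))
    (hdC : ∀ n, ∀ᵐ ω ∂μ, |d n ω| ≤ C) (hd0 : ∀ n, μ[d n|𝒢 n] =ᵐ[μ] 0)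
    (hN : ∀ n ω, ∑ k ∈ Finset.range n, c k ω ^ 2 ≤ N) :
    ∀ᵐ ω ∂μ, ∃ l, Tendsto (fun n => ∑ k ∈ Finset.range n, c k ω * d k ω) atTop (𝓝 l) := by
  obtain ⟨ω₀⟩ : Nonempty Ω := nonempty_of_isProbabilityMeasure μ
  have hN0 : 0 ≤ N := by simpa using hN 0 ω₀
  have hcb : ∀ n ω, |c n ω| ≤ N + 1 := by
    intro n ω
    have h1 : c n ω ^ 2 ≤ N := by
      refine le_trans ?_ (hN (n + 1) ω)
      exact Finset.single_le_sum (f := fun k => c k ω ^ 2) (fun k _ => sq_nonneg _)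
        (Finset.self_mem_range_succ n)
    rw [← sq_abs] at h1
    nlinarith [abs_nonneg (c n ω)]
  set M : ℕ → Ω → ℝ := fun n ω => ∑ k ∈ Finset.range n, c k ω * d k ω with hM
  have hcm : ∀ n, Measurable (c n) := fun n => (hc n).mono (𝒢.le n) le_rfl
  have hdm : ∀ n, Measurable (d n) := fun n => (hd n).mono (𝒢.le _) le_rfl
  have hMa : ∀ n, Measurable[𝒢 n] (M n) := by
    intro n
    refine Finset.measurable_fun_sum _ fun k hk => ?_
    have hk' := Finset.mem_range.1 hk
    exact ((hc k).mono (𝒢.mono hk'.le) le_rfl).mul ((hd k).mono (𝒢.mono hk') le_rfl)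
  have hMm : ∀ n, Measurable (M n) := fun n => (hMa n).mono (𝒢.le n) le_rfl
  have hdC' : ∀ᵐ ω ∂μ, ∀ n, |d n ω| ≤ C := ae_all_iff.2 hdC
  have hMb : ∀ n, ∀ᵐ ω ∂μ, |M n ω| ≤ n * ((N + 1) * C) := by
    intro n
    filter_upwards [hdC'] with ω hω
    refine (Finset.abs_sum_le_sum_abs _ _).trans ?_
    refine (Finset.sum_le_card_nsmul _ _ ((N + 1) * C) fun k _ => ?_).trans (by simp)
    rw [abs_mul]
    exact mul_le_mul (hcb k ω) (hω k) (abs_nonneg _) (by linarith)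
  have hint : ∀ n, Integrable (M n) μ := fun n =>
    Integrable.of_bound (hMm n).aestronglyMeasurable _ (hMb n)
  have hdint : ∀ n, Integrable (d n) μ := fun n =>
    Integrable.of_bound (hdm n).aestronglyMeasurable _ (hdC n)
  have hpull : ∀ n (g : Ω → ℝ) (K : ℝ), Measurable[𝒢 n] g → (∀ᵐ ω ∂μ, |g ω| ≤ K) →
      Integrable (g * d n) μ ∧ μ[g * d n|𝒢 n] =ᵐ[μ] 0 := by
    intro n g K hg hgK
    have hi : Integrable (g * d n) μ := by
      refine (hdint n).bdd_mul (c := K) (hg.mono (𝒢.le n) le_rfl).aestronglyMeasurable ?_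
      simpa [Real.norm_eq_abs] using hgK
    refine ⟨hi, ?_⟩
    filter_upwards [condExp_mul_of_stronglyMeasurable_left hg.stronglyMeasurable hi (hdint n),
      hd0 n] with ω h1 h2
    rw [h1, Pi.mul_apply, h2]
    simp
  have hmart : Martingale M 𝒢 μ := by
    refine martingale_of_condExp_sub_eq_zero_nat (fun n => (hMa n).stronglyMeasurable) hint
      fun n => ?_
    have : M (n + 1) - M n = c n * d n := by
      ext ω
      simp [hM, Finset.sum_range_succ]
    rw [this]
    exact (hpull n (c n) (N + 1) (hc n) (Eventually.of_forall (hcb n))).2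
  have hsqint : ∀ n, Integrable (fun ω => M n ω ^ 2) μ := fun n => by
    refine Integrable.of_bound ((hMm n).pow_const 2).aestronglyMeasurable
      ((n * ((N + 1) * C)) ^ 2) ?_
    filter_upwards [hMb n] with ω hω
    rw [Real.norm_eq_abs, abs_pow]
    exact pow_le_pow_left₀ (abs_nonneg _) hω 2
  have hc2int : ∀ n, Integrable (fun ω => c n ω ^ 2) μ := fun n => by
    refine Integrable.of_bound ((hcm n).pow_const 2).aestronglyMeasurable ((N + 1) ^ 2)
      (Eventually.of_forall fun ω => ?_)
    rw [Real.norm_eq_abs, abs_pow]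
    exact pow_le_pow_left₀ (abs_nonneg _) (hcb n ω) 2
  have hL2 : ∀ n, ∫ ω, M n ω ^ 2 ∂μ ≤ C ^ 2 * ∫ ω, ∑ k ∈ Finset.range n, c k ω ^ 2 ∂μ := by
    intro n
    induction n with
    | zero => simp [hM]
    | succ n ih =>
      obtain ⟨hi, h0⟩ := hpull n (M n * c n) (n * ((N + 1) * C) * (N + 1)) ((hMa n).mul (hc n)) (by
        filter_upwards [hMb n] with ω hω
        rw [Pi.mul_apply, abs_mul]
        exact mul_le_mul hω (hcb n ω) (abs_nonneg _) ((abs_nonneg _).trans hω))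
      -- M n * c n is bounded and 𝒢 n-measurable, so it can be pulled out of the conditional
      -- expectation of d n.
      have hcross : ∫ ω, (M n * c n * d n) ω ∂μ = 0 := by
        rw [← integral_condExp (𝒢.le n), integral_congr_ae h0]
        simp
      have hle : ∫ ω, M (n + 1) ω ^ 2 ∂μ ≤
          ∫ ω, (M n ω ^ 2 + 2 * (M n * c n * d n) ω + C ^ 2 * c n ω ^ 2) ∂μ := by
        refine integral_mono_ae (hsqint _)
          (((hsqint n).add (hi.const_mul 2)).add ((hc2int n).const_mul _)) ?_
        filter_upwards [hdC n] with ω hω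
        have h1 : M (n + 1) ω = M n ω + c n ω * d n ω := by
          simp [hM, Finset.sum_range_succ]
        have h2 : d n ω ^ 2 ≤ C ^ 2 := by
          rw [← sq_abs]
          exact pow_le_pow_left₀ (abs_nonneg _) hω 2
        have h3 := mul_le_mul_of_nonneg_left h2 (sq_nonneg (c n ω))
        simp only [Pi.mul_apply, h1]
        nlinarith
      have hadd : Integrable (fun ω => M n ω ^ 2 + 2 * (M n * c n * d n) ω) μ :=
        (hsqint n).add (hi.const_mul 2)
      refine hle.trans ?_
      rw [integral_add hadd ((hc2int n).const_mul _),
        integral_add (hsqint n) (hi.const_mul 2), integral_const_mul, integral_const_mul, hcross]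
      have : ∫ ω, ∑ k ∈ Finset.range (n + 1), c k ω ^ 2 ∂μ =
          ∫ ω, ∑ k ∈ Finset.range n, c k ω ^ 2 ∂μ + ∫ ω, c n ω ^ 2 ∂μ := by
        simp_rw [Finset.sum_range_succ]
        exact integral_add (integrable_finsetSum _ fun k _ => hc2int k) (hc2int n)
      rw [this]
      linarith
  have hL2' : ∀ n, ∫ ω, M n ω ^ 2 ∂μ ≤ C ^ 2 * N := by
    intro n
    refine (hL2 n).trans (mul_le_mul_of_nonneg_left ?_ (sq_nonneg _))
    calc ∫ ω, ∑ k ∈ Finset.range n, c k ω ^ 2 ∂μ ≤ ∫ _, N ∂μ :=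
          integral_mono (integrable_finsetSum _ fun k _ => hc2int k) (integrable_const _) (hN n)
      _ = N := by simp
  have hL1 : ∀ n, eLpNorm (M n) 1 μ ≤ (C ^ 2 * N + 1).toNNReal := by
    intro n
    rw [eLpNorm_one_eq_lintegral_enorm, ← ofReal_integral_norm_eq_lintegral_enorm (hint n)]
    refine ENNReal.ofReal_le_ofReal ?_
    calc ∫ ω, ‖M n ω‖ ∂μ ≤ ∫ ω, (M n ω ^ 2 + 1) ∂μ := by
          refine integral_mono (hint n).norm ((hsqint n).add (integrable_const _)) fun ω => ?_
          simp only [Real.norm_eq_abs]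
          nlinarith [sq_abs (M n ω), abs_nonneg (M n ω)]
      _ = ∫ ω, M n ω ^ 2 ∂μ + 1 := by
          rw [integral_add (hsqint n) (integrable_const _)]
          simp
      _ ≤ _ := by linarith [hL2' n]
  filter_upwards [hmart.submartingale.ae_tendsto_limitProcess hL1] with ω hω
  exact ⟨_, hω⟩

/-- Localization: the coefficients are cut off once their sum of squares exceeds N. Almost every
path is untouched by the cut-off for some N. -/
theorem ae_tendsto_martingale_transform
    (hc : ∀ n, Measurable[𝒢 n] (c n)) (hd : ∀ n, Measurable[𝒢 (n + 1)] (d n))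
    (hdC : ∀ n, ∀ᵐ ω ∂μ, |d n ω| ≤ C) (hd0 : ∀ n, μ[d n|𝒢 n] =ᵐ[μ] 0)
    (hsq : ∀ᵐ ω ∂μ, Summable fun n => c n ω ^ 2) :
    ∀ᵐ ω ∂μ, ∃ l, Tendsto (fun n => ∑ k ∈ Finset.range n, c k ω * d k ω) atTop (𝓝 l) := by
  set A : ℕ → Ω → ℝ := fun n ω => ∑ k ∈ Finset.range n, c k ω ^ 2 with hA
  have hAm : ∀ n, Measurable[𝒢 n] (A (n + 1)) := fun n =>
    Finset.measurable_fun_sum _ fun k hk =>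
      ((hc k).mono (𝒢.mono (Nat.lt_succ_iff.1 (Finset.mem_range.1 hk))) le_rfl).pow_const 2
  -- A (n + 1) involves only c 0, …, c n, so the cut-off coefficient is still 𝒢 n-measurable.
  set c' : ℕ → ℕ → Ω → ℝ := fun N n ω => if A (n + 1) ω ≤ N then c n ω else 0 with hc'
  -- The bound by A n is what makes the induction close: it yields the bound N at an index where the
  -- coefficient is kept.
  have hbound : ∀ N n ω, ∑ k ∈ Finset.range n, c' N k ω ^ 2 ≤ min (A n ω) N := by
    intro N n ω
    induction n with
    | zero => simp [hA]
    | succ n ih =>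
      have hAs : A (n + 1) ω = A n ω + c n ω ^ 2 := by simp [hA, Finset.sum_range_succ]
      obtain ⟨h1, h2⟩ := le_min_iff.1 ih
      rw [Finset.sum_range_succ]
      by_cases h : A (n + 1) ω ≤ N
      · simp only [hc', h, if_true] at h1 ⊢
        exact le_min (by linarith) (by linarith)
      · simp only [hc', h, if_false] at h1 h2 ⊢
        exact le_min (by nlinarith [sq_nonneg (c n ω)]) (by linarith)
  have hconv : ∀ᵐ ω ∂μ, ∀ N, ∃ l,
      Tendsto (fun n => ∑ k ∈ Finset.range n, c' N k ω * d k ω) atTop (𝓝 l) :=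
    ae_all_iff.2 fun N => ae_tendsto_martingale_transform_of_bounded
      (fun n => Measurable.ite (measurableSet_le (hAm n) measurable_const) (hc n)
        measurable_const) hd hdC hd0 fun n ω => (hbound N n ω).trans (min_le_right _ _)
  filter_upwards [hconv, hsq] with ω h1 h2
  obtain ⟨N, hN⟩ := exists_nat_ge (∑' n, c n ω ^ 2)
  have : ∀ k, c' N k ω = c k ω := fun k =>
    if_pos ((h2.sum_le_tsum _ fun _ _ => sq_nonneg _).trans hN)
  simpa only [this] using h1 N

end MartingaleTransform

/-! ### One-step conditional laws of the trajectory -/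

theorem sum_toReal_pmf {X : Type*} [Fintype X] (p : PMF X) : ∑ x, (p x).toReal = 1 := by
  rw [← ENNReal.toReal_sum fun x _ => p.apply_ne_top x,
    ← tsum_fintype (L := .unconditional _), p.tsum_coe, ENNReal.toReal_one]

theorem MDP.pairMatrix_mem_rowStochastic {S A : Type*} [Fintype S] [Fintype A] [DecidableEq S]
    [DecidableEq A] (M : MDP S A) (π : S → PMF A) :
    M.pairMatrix π ∈ Matrix.rowStochastic ℝ (S × A) := by
  refine Matrix.mem_rowStochastic_iff_sum.2
    ⟨fun _ _ => mul_nonneg ENNReal.toReal_nonneg ENNReal.toReal_nonneg, fun x => ?_⟩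
  simp only [pairMatrix, Fintype.sum_prod_type, ← Finset.mul_sum, sum_toReal_pmf, mul_one]

section Trajectory

variable {S A : Type*} [Fintype S] [Fintype A] [MeasurableSpace S] [MeasurableSingletonClass S]
  [MeasurableSpace A] [MeasurableSingletonClass A]
  {Ω : Type*} {mΩ : MeasurableSpace Ω} {μ : Measure Ω}
  {ℱ : Filtration ℕ mΩ} {M : MDP S A} {π : S → PMF A}
  {s : ℕ → Ω → S} {a : ℕ → Ω → A} {r : ℕ → Ω → ℝ}

theorem IsTrajectory.measurable_comp (h : IsTrajectory M π μ ℱ s a r) (f : S × A → ℝ) (t : ℕ) :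
    Measurable[ℱ t] fun ω => f (s t ω, a t ω) :=
  (measurable_of_finite f).comp ((h.state_meas t).prodMk (h.action_meas t))

variable [IsProbabilityMeasure μ]

/-- The Markov property integrated over a past event E, with the current pair summed out. It
determines the law of the next reward on E. -/
theorem IsTrajectory.measureReal_inter (h : IsTrajectory M π μ ℱ s a r) (t : ℕ) (z : S × A)
    {B : Set ℝ} (hB : MeasurableSet B) {E : Set Ω} (hE : MeasurableSet[ℱ t] E) :
    μ.real (E ∩ {ω | s (t + 1) ω = z.1 ∧ a (t + 1) ω = z.2 ∧ r (t + 1) ω ∈ B}) =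
      ∑ x : S × A, ((μ.restrict E).map fun ω => (s t ω, a t ω)).real {x} *
        (M.pairMatrix π x z * (M.rewardLaw x.1 x.2 z.1 : Measure ℝ).real B) := by
  have hxm : Measurable fun ω => (s t ω, a t ω) :=
    ((h.state_meas t).mono (ℱ.le t) le_rfl).prodMk ((h.action_meas t).mono (ℱ.le t) le_rfl)
  have hZ : MeasurableSet {ω | s (t + 1) ω = z.1 ∧ a (t + 1) ω = z.2 ∧ r (t + 1) ω ∈ B} := by
    refine MeasurableSet.inter ?_ (MeasurableSet.inter ?_ ?_)
    · exact ((h.state_meas (t + 1)).mono (ℱ.le _) le_rfl) (measurableSet_singleton z.1)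
    · exact ((h.action_meas (t + 1)).mono (ℱ.le _) le_rfl) (measurableSet_singleton z.2)
    · exact ((h.reward_meas (t + 1)).mono (ℱ.le _) le_rfl) hB
  set g : S × A → ℝ := fun x =>
    M.pairMatrix π x z * (M.rewardLaw x.1 x.2 z.1 : Measure ℝ).real B with hg
  calc _ = ∫ ω in E, Set.indicator
        {ω | s (t + 1) ω = z.1 ∧ a (t + 1) ω = z.2 ∧ r (t + 1) ω ∈ B} (fun _ => (1 : ℝ)) ω ∂μ := by
        rw [setIntegral_indicator hZ, setIntegral_const, smul_eq_mul, mul_one]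
    _ = ∫ ω in E, g (s t ω, a t ω) ∂μ := by
        rw [← setIntegral_condExp (ℱ.le t) ((integrable_const _).indicator hZ) hE]
        refine integral_congr_ae (ae_restrict_of_ae ?_)
        filter_upwards [h.markov t z.1 z.2 B hB] with ω hω
        rw [hω]
        simp only [hg, MDP.pairMatrix]
        ring
    _ = ∫ x, g x ∂((μ.restrict E).map fun ω => (s t ω, a t ω)) :=
        (integral_map hxm.aemeasurable (measurable_of_finite g).aestronglyMeasurable).symm
    _ = _ := by
        rw [integral_fintype (.of_finite)]
        simp only [smul_eq_mul, hg]

theorem IsTrajectory.ae_abs_reward_le (h : IsTrajectory M π μ ℱ s a r) {R : ℝ}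
    (hR : ∀ s a s', ∀ᵐ x ∂(M.rewardLaw s a s' : Measure ℝ), |x| ≤ R) :
    ∀ᵐ ω ∂μ, ∀ t, |r (t + 1) ω| ≤ R := by
  refine ae_all_iff.2 fun t => ?_
  have hB : MeasurableSet {x : ℝ | |x| ≤ R}ᶜ :=
    (measurableSet_le measurable_norm measurable_const).compl
  have key : ∀ z : S × A, ∀ᵐ ω ∂μ,
      ¬(s (t + 1) ω = z.1 ∧ a (t + 1) ω = z.2 ∧ r (t + 1) ω ∈ {x : ℝ | |x| ≤ R}ᶜ) := by
    intro z
    have h1 := h.measureReal_inter t z hB MeasurableSet.univ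
    rw [Finset.sum_eq_zero, Set.univ_inter, measureReal_eq_zero_iff] at h1
    · rw [ae_iff]
      simpa only [not_not] using h1
    · intro x _
      have : (M.rewardLaw x.1 x.2 z.1 : Measure ℝ).real {x : ℝ | |x| ≤ R}ᶜ = 0 := by
        rw [measureReal_eq_zero_iff]
        exact hR _ _ _
      rw [this]
      simp
  filter_upwards [ae_all_iff.2 key] with ω hω
  by_contra hc
  exact hω (s (t + 1) ω, a (t + 1) ω) ⟨rfl, rfl, hc⟩

variable [DecidableEq S] [DecidableEq A]

theorem IsTrajectory.condExp_transition (h : IsTrajectory M π μ ℱ s a r) (t : ℕ) (z : S × A) :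
    μ[fun ω => (if (s (t + 1) ω, a (t + 1) ω) = z then 1 else 0) -
      M.pairMatrix π (s t ω, a t ω) z|ℱ t] =ᵐ[μ] 0 := by
  have hm := h.measurable_comp (fun x => M.pairMatrix π x z) t
  have hm' := h.measurable_comp (fun x => if x = z then (1 : ℝ) else 0) (t + 1)
  have hi : Integrable (fun ω => M.pairMatrix π (s t ω, a t ω) z) μ := by
    refine Integrable.of_bound (hm.mono (ℱ.le t) le_rfl).aestronglyMeasurable 1
      (Eventually.of_forall fun ω => ?_)
    rw [Real.norm_eq_abs, abs_of_nonneg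
      (Matrix.nonneg_of_mem_rowStochastic (M.pairMatrix_mem_rowStochastic π))]
    exact Matrix.le_one_of_mem_rowStochastic (M.pairMatrix_mem_rowStochastic π)
  have hi' : Integrable (fun ω => if (s (t + 1) ω, a (t + 1) ω) = z then (1 : ℝ) else 0) μ := by
    refine Integrable.of_bound (hm'.mono (ℱ.le _) le_rfl).aestronglyMeasurable 1
      (Eventually.of_forall fun ω => ?_)
    split_ifs <;> simp
  have heq : (fun ω => if (s (t + 1) ω, a (t + 1) ω) = z then (1 : ℝ) else 0) =
      Set.indicator {ω | s (t + 1) ω = z.1 ∧ a (t + 1) ω = z.2 ∧ r (t + 1) ω ∈ Set.univ}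
        (fun _ => (1 : ℝ)) := by
    ext ω
    simp [Set.indicator_apply, Prod.ext_iff]
  have h1 := condExp_sub hi' hi (ℱ t)
  rw [condExp_of_stronglyMeasurable (ℱ.le t) hm.stronglyMeasurable hi] at h1
  have h2 := h.markov t z.1 z.2 Set.univ MeasurableSet.univ
  rw [← heq] at h2
  filter_upwards [h1, h2] with ω h1 h2
  refine h1.trans ?_
  rw [Pi.sub_apply, h2]
  simp [MDP.pairMatrix]

/-- The Markov property concerns probabilities of events only. To reach expectations, the law of r
(t + 1) on E ∩ {next pair = z} is identified as a finite mixture of reward laws, and then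
integrated. -/
theorem IsTrajectory.setIntegral_reward (h : IsTrajectory M π μ ℱ s a r) {R : ℝ}
    (hR : ∀ s a s', ∀ᵐ x ∂(M.rewardLaw s a s' : Measure ℝ), |x| ≤ R) (t : ℕ)
    {E : Set Ω} (hE : MeasurableSet[ℱ t] E) :
    ∫ ω in E, r (t + 1) ω ∂μ = ∫ ω in E, M.meanReward (s t ω) (a t ω) ∂μ := by
  have hE' : MeasurableSet E := ℱ.le t _ hE
  have hxm : ∀ t, Measurable fun ω => (s t ω, a t ω) := fun t =>
    ((h.state_meas t).mono (ℱ.le t) le_rfl).prodMk ((h.action_meas t).mono (ℱ.le t) le_rfl)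
  have hrm : Measurable (r (t + 1)) := (h.reward_meas (t + 1)).mono (ℱ.le _) le_rfl
  have hri : Integrable (r (t + 1)) μ := by
    refine Integrable.of_bound hrm.aestronglyMeasurable R ?_
    filter_upwards [h.ae_abs_reward_le hR] with ω hω using hω t
  set m := (μ.restrict E).map fun ω => (s t ω, a t ω) with hm
  set Z : S × A → Set Ω := fun z => {ω | (s (t + 1) ω, a (t + 1) ω) = z} with hZ
  have hZm : ∀ z, MeasurableSet (Z z) := fun z => hxm (t + 1) (measurableSet_singleton z)
  set w : S × A → S × A → ℝ := fun x z => m.real {x} * M.pairMatrix π x z with hw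
  have hw0 : ∀ x z, 0 ≤ w x z := fun x z => mul_nonneg measureReal_nonneg
    (Matrix.nonneg_of_mem_rowStochastic (M.pairMatrix_mem_rowStochastic π))
  have hlaw : ∀ z, (μ.restrict (E ∩ Z z)).map (r (t + 1)) =
      ∑ x : S × A, ENNReal.ofReal (w x z) • (M.rewardLaw x.1 x.2 z.1 : Measure ℝ) := by
    intro z
    ext B hB
    rw [Measure.map_apply hrm hB, Measure.restrict_apply (hrm hB)]
    have hset : r (t + 1) ⁻¹' B ∩ (E ∩ Z z) =
        E ∩ {ω | s (t + 1) ω = z.1 ∧ a (t + 1) ω = z.2 ∧ r (t + 1) ω ∈ B} := by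
      ext ω
      simp only [hZ, Set.mem_inter_iff, Set.mem_preimage, Set.mem_ofPred_eq, Prod.ext_iff]
      tauto
    rw [hset, ← ofReal_measureReal, h.measureReal_inter t z hB hE,
      ENNReal.ofReal_sum_of_nonneg fun x _ => by
        have := hw0 x z
        rw [← mul_assoc]
        exact mul_nonneg this measureReal_nonneg]
    simp only [Measure.coe_finsetSum, Finset.sum_apply, Measure.smul_apply, smul_eq_mul]
    refine Finset.sum_congr rfl fun x _ => ?_
    rw [← mul_assoc, ENNReal.ofReal_mul (hw0 x z), ofReal_measureReal]
  have hlawint : ∀ x y z, Integrable (fun v : ℝ => v) (M.rewardLaw x y z : Measure ℝ) :=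
    fun x y z => Integrable.of_bound measurable_id.aestronglyMeasurable R (hR x y z)
  have hpart : ∀ z, ∫ ω in E ∩ Z z, r (t + 1) ω ∂μ =
      ∑ x : S × A, w x z * ∫ v, v ∂(M.rewardLaw x.1 x.2 z.1 : Measure ℝ) := by
    intro z
    rw [← integral_map (f := fun v : ℝ => v) hrm.aemeasurable measurable_id.aestronglyMeasurable,
      hlaw z, integral_finsetSum_measure fun x _ => (hlawint _ _ _).smul_measure
        ENNReal.ofReal_ne_top]
    simp only [integral_smul_measure, ENNReal.toReal_ofReal (hw0 _ _), smul_eq_mul]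
  have hEun : E = ⋃ z, E ∩ Z z := by
    ext ω
    simp [hZ]
  calc ∫ ω in E, r (t + 1) ω ∂μ = ∑ z, ∫ ω in E ∩ Z z, r (t + 1) ω ∂μ := by
        conv_lhs => rw [hEun]
        refine integral_iUnion_fintype (fun z => hE'.inter (hZm z)) ?_ fun z => hri.integrableOn
        intro z z' hzz
        refine Set.disjoint_left.2 fun ω h1 h2 => hzz ?_
        exact (h1.2 : _ = z).symm.trans h2.2
    _ = ∑ x : S × A, m.real {x} * M.meanReward x.1 x.2 := by
        simp only [hpart]
        rw [Finset.sum_comm]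
        refine Finset.sum_congr rfl fun x _ => ?_
        simp only [hw, MDP.meanReward, MDP.pairMatrix, Fintype.sum_prod_type, Finset.mul_sum]
        refine Finset.sum_congr rfl fun y _ => ?_
        rw [← mul_one (m.real {x} * _), ← sum_toReal_pmf (π y), Finset.mul_sum]
        refine Finset.sum_congr rfl fun b _ => ?_
        ring
    _ = ∫ x, M.meanReward x.1 x.2 ∂m := by
        rw [integral_fintype (.of_finite)]
        simp only [smul_eq_mul]
    _ = _ := integral_map (f := fun x : S × A => M.meanReward x.1 x.2) (hxm t).aemeasurable
        (measurable_of_finite _).aestronglyMeasurable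

theorem IsTrajectory.condExp_reward (h : IsTrajectory M π μ ℱ s a r) {R : ℝ}
    (hR : ∀ s a s', ∀ᵐ x ∂(M.rewardLaw s a s' : Measure ℝ), |x| ≤ R) (t : ℕ) :
    μ[fun ω => r (t + 1) ω - M.meanReward (s t ω) (a t ω)|ℱ t] =ᵐ[μ] 0 := by
  have hri : Integrable (r (t + 1)) μ := by
    refine Integrable.of_bound
      ((h.reward_meas (t + 1)).mono (ℱ.le _) le_rfl).aestronglyMeasurable R ?_
    filter_upwards [h.ae_abs_reward_le hR] with ω hω using hω t
  have hmm := (h.measurable_comp (fun x => M.meanReward x.1 x.2) t).mono (ℱ.le t) le_rfl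
  obtain ⟨K, hK⟩ := (Set.finite_range fun x : S × A => |M.meanReward x.1 x.2|).bddAbove
  have hmi : Integrable (fun ω => M.meanReward (s t ω) (a t ω)) μ :=
    Integrable.of_bound hmm.aestronglyMeasurable K
      (Eventually.of_forall fun ω => hK ⟨(s t ω, a t ω), rfl⟩)
  refine (ae_eq_condExp_of_forall_setIntegral_eq (ℱ.le t) (hri.sub hmi)
    (fun _ _ _ => (integrable_zero _ _ _).integrableOn) (fun E hE _ => ?_)
    aestronglyMeasurable_zero).symm
  have : ∫ ω in E, (r (t + 1) - fun ω => M.meanReward (s t ω) (a t ω)) ω ∂μ =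
      ∫ ω in E, r (t + 1) ω ∂μ - ∫ ω in E, M.meanReward (s t ω) (a t ω) ∂μ :=
    integral_sub hri.integrableOn hmi.integrableOn
  rw [this, h.setIntegral_reward hR t hE, sub_self]
  simp

end Trajectory

/-! ### Contraction and boundedness of operators and sampled targets -/

theorem abs_mulVec_le_of_mem_rowStochastic {X : Type*} [Fintype X] [DecidableEq X]
    {P : Matrix X X ℝ} (hP : P ∈ Matrix.rowStochastic ℝ X) {f : X → ℝ} {K : ℝ}
    (hf : ∀ x, |f x| ≤ K) (x : X) : |P.mulVec f x| ≤ K := by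
  calc |P.mulVec f x| ≤ ∑ y, |P x y * f y| := Finset.abs_sum_le_sum_abs _ _
    _ ≤ ∑ y, P x y * K := Finset.sum_le_sum fun y _ => by
        rw [abs_mul, abs_of_nonneg (Matrix.nonneg_of_mem_rowStochastic hP)]
        exact mul_le_mul_of_nonneg_left (hf y) (Matrix.nonneg_of_mem_rowStochastic hP)
    _ = K := by rw [← Finset.sum_mul, Matrix.sum_row_of_mem_rowStochastic hP, one_mul]

theorem abs_average_le {L : ℕ} {u : ℕ → ℝ} {c : ℝ} (hL : 1 ≤ L)
    (h : ∀ l ∈ Finset.Icc 1 L, |u l| ≤ c) :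
    |(1 / (L : ℝ)) * ∑ l ∈ Finset.Icc 1 L, u l| ≤ c := by
  have hL0 : (0 : ℝ) < L := by exact_mod_cast hL
  rw [abs_mul, abs_of_pos (by positivity : 0 < 1 / (L : ℝ)), one_div, inv_mul_le_iff₀ hL0]
  refine (Finset.abs_sum_le_sum_abs _ _).trans ((Finset.sum_le_card_nsmul _ _ c h).trans ?_)
  simp

section MaxQ

variable {S A : Type*} [Fintype A] [Nonempty A]

theorem abs_maxQ_le {q : S → A → ℝ} {D : ℝ} (h : ∀ x y, |q x y| ≤ D) (y : S) :
    |maxQ q y| ≤ D := by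
  obtain ⟨b⟩ := ‹Nonempty A›
  refine abs_le.2 ⟨?_, Finset.sup'_le _ _ fun b _ => (abs_le.1 (h y b)).2⟩
  exact (abs_le.1 (h y b)).1.trans (Finset.le_sup' (q y) (Finset.mem_univ b))

theorem maxQ_le_maxQ_add {q q' : S → A → ℝ} {D : ℝ} (h : ∀ x y, |q x y - q' x y| ≤ D) (y : S) :
    maxQ q y ≤ maxQ q' y + D :=
  Finset.sup'_le _ _ fun b _ => by
    have h1 : q' y b ≤ maxQ q' y := Finset.le_sup' (q' y) (Finset.mem_univ b)
    linarith [(abs_le.1 (h y b)).2]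

theorem abs_maxQ_sub_le {q q' : S → A → ℝ} {D : ℝ} (h : ∀ x y, |q x y - q' x y| ≤ D) (y : S) :
    |maxQ q y - maxQ q' y| ≤ D :=
  abs_sub_le_iff.2 ⟨by linarith [maxQ_le_maxQ_add h y], by
    linarith [maxQ_le_maxQ_add (fun x y => (abs_sub_comm (q' x y) _).trans_le (h x y)) y]⟩

theorem measurable_maxQ {Ω : Type*} {m : MeasurableSpace Ω} {q : Ω → S → A → ℝ} {y : S}
    (hq : ∀ b, Measurable fun ω => q ω y b) : Measurable fun ω => maxQ (q ω) y := by
  have := Finset.measurable_sup' Finset.univ_nonempty fun b (_ : b ∈ Finset.univ) => hq b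
  convert this using 1
  ext ω
  rw [Finset.sup'_apply]
  rfl

/-- The average over `l` of the `l`-step targets at time `t`. -/
noncomputable def tdTarget (γ : ℝ) (L : ℕ) (s : ℕ → S) (r : ℕ → ℝ) (q : S → A → ℝ) (t : ℕ) : ℝ :=
  (1 / (L : ℝ)) * ∑ l ∈ Finset.Icc 1 L,
    (∑ i ∈ Finset.Icc 1 l, γ ^ (i - 1) * r (t + i) + γ ^ l * maxQ q (s (t + l)))

theorem tdError_eq {L : ℕ} (hL : 1 ≤ L) (γ : ℝ) (s : ℕ → S) (a : ℕ → A) (r : ℕ → ℝ)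
    (q : S → A → ℝ) (t : ℕ) :
    tdError γ L s a r q t = tdTarget γ L s r q t - q (s t) (a t) := by
  have hL0 : (L : ℝ) ≠ 0 := by exact_mod_cast (by omega : L ≠ 0)
  simp only [tdError, tdTarget, Finset.sum_sub_distrib, mul_sub]
  congr 1
  simp [hL0]

theorem pow_mul_le_mul {γ D : ℝ} (hγ0 : 0 ≤ γ) (hγ1 : γ ≤ 1) (hD : 0 ≤ D) {l : ℕ} (hl : 1 ≤ l) :
    γ ^ l * D ≤ γ * D :=
  mul_le_mul_of_nonneg_right (pow_le_of_le_one hγ0 hγ1 (by omega)) hD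

theorem abs_tdTarget_sub_le {γ : ℝ} (hγ0 : 0 ≤ γ) (hγ1 : γ ≤ 1) {L : ℕ} (hL : 1 ≤ L) (s : ℕ → S)
    (r : ℕ → ℝ) {q q' : S → A → ℝ} {D : ℝ} (h : ∀ x y, |q x y - q' x y| ≤ D) (t : ℕ) :
    |tdTarget γ L s r q t - tdTarget γ L s r q' t| ≤ γ * D := by
  rw [tdTarget, tdTarget, ← mul_sub, ← Finset.sum_sub_distrib]
  refine abs_average_le hL fun l hl => ?_
  have h1 := abs_maxQ_sub_le h (s (t + l))
  rw [add_sub_add_left_eq_sub, ← mul_sub, abs_mul, abs_of_nonneg (pow_nonneg hγ0 l)]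
  exact (mul_le_mul_of_nonneg_left h1 (pow_nonneg hγ0 l)).trans
    (pow_mul_le_mul hγ0 hγ1 ((abs_nonneg _).trans h1) (Finset.mem_Icc.1 hl).1)

/-- As B = R + γ B, the l discounted rewards contribute at most B - γ^l B and the bootstrap term at
most γ^l B. -/
theorem abs_tdTarget_le {γ : ℝ} (hγ0 : 0 ≤ γ) {L : ℕ} (hL : 1 ≤ L) (s : ℕ → S)
    {r : ℕ → ℝ} {R B : ℝ} (hr : ∀ t, |r (t + 1)| ≤ R) (hB : R + γ * B = B)
    {q : S → A → ℝ} (hq : ∀ x y, |q x y| ≤ B) (t : ℕ) :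
    |tdTarget γ L s r q t| ≤ B := by
  have h1 : ∀ l, |∑ i ∈ Finset.Icc 1 l, γ ^ (i - 1) * r (t + i)| ≤ B - γ ^ l * B := by
    intro l
    induction l with
    | zero => simp
    | succ l ih =>
      rw [Finset.sum_Icc_succ_top (by omega), Nat.add_sub_cancel]
      refine (abs_add_le _ _).trans ?_
      rw [abs_mul, abs_of_nonneg (pow_nonneg hγ0 l), ← add_assoc]
      have h2 := mul_le_mul_of_nonneg_left (hr (t + l)) (pow_nonneg hγ0 l)
      have h3 : γ ^ l * (R + γ * B) = γ ^ l * B := by rw [hB]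
      rw [pow_succ]
      linarith
  refine abs_average_le hL fun l _ => ?_
  have h2 := mul_le_mul_of_nonneg_left (abs_maxQ_le hq (s (t + l))) (pow_nonneg hγ0 l)
  refine (abs_add_le _ _).trans ?_
  rw [abs_mul, abs_of_nonneg (pow_nonneg hγ0 l)]
  linarith [h1 l]

end MaxQ

section Operators

variable {S A : Type*} [Fintype S] [Fintype A] [DecidableEq S] [DecidableEq A]

theorem MDP.accReward_eq (M : MDP S A) (π : S → PMF A) (l : ℕ) (x : S) (y : A) :
    M.accReward π l x y = ∑ i ∈ Finset.Icc 1 l, M.γ ^ (i - 1) *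
      (M.pairMatrix π ^ (i - 1)).mulVec (fun z => M.meanReward z.1 z.2) (x, y) := rfl

variable [Nonempty A]

/-- The weights p_l(y | s, a) sum to 1 over y, so the accumulated reward leaves the sum. -/
theorem MDP.H_eq (M : MDP S A) (π : S → PMF A) (l : ℕ) (q : S → A → ℝ) (x : S) (y : A) :
    M.H π l q x y = M.accReward π l x y +
      M.γ ^ l * (M.pairMatrix π ^ l).mulVec (fun z => maxQ q z.1) (x, y) := by
  have h1 := Matrix.sum_row_of_mem_rowStochastic
    (pow_mem (M.pairMatrix_mem_rowStochastic π) l) (x, y)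
  rw [Fintype.sum_prod_type] at h1
  simp only [H, stepProb, mul_add, Finset.sum_add_distrib, ← Finset.sum_mul, h1, one_mul]
  congr 1
  simp only [Matrix.mulVec, dotProduct, Fintype.sum_prod_type, Finset.mul_sum, Finset.sum_mul]
  refine Finset.sum_congr rfl fun _ _ => Finset.sum_congr rfl fun _ _ => ?_
  ring

theorem MDP.abs_avgH_sub_le (M : MDP S A) (π : S → PMF A) (hγ0 : 0 ≤ M.γ) (hγ1 : M.γ ≤ 1)
    {L : ℕ} (hL : 1 ≤ L) {q q' : S → A → ℝ} {D : ℝ} (h : ∀ x y, |q x y - q' x y| ≤ D)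
    (x : S) (y : A) : |M.avgH π L q x y - M.avgH π L q' x y| ≤ M.γ * D := by
  rw [avgH, avgH, ← mul_sub, ← Finset.sum_sub_distrib]
  refine abs_average_le hL fun l hl => ?_
  have h1 := abs_mulVec_le_of_mem_rowStochastic (pow_mem (M.pairMatrix_mem_rowStochastic π) l)
    (f := (fun z => maxQ q z.1) - fun z => maxQ q' z.1) (fun z => abs_maxQ_sub_le h z.1) (x, y)
  rw [H_eq, H_eq, add_sub_add_left_eq_sub, ← mul_sub, abs_mul, abs_of_nonneg (pow_nonneg hγ0 l)]
  rw [Matrix.mulVec_sub, Pi.sub_apply] at h1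
  exact (mul_le_mul_of_nonneg_left h1 (pow_nonneg hγ0 l)).trans
    (pow_mul_le_mul hγ0 hγ1 ((abs_nonneg _).trans h1) (Finset.mem_Icc.1 hl).1)

theorem MDP.exists_unique_fixedPoint_avgH (M : MDP S A) (π : S → PMF A) (hγ0 : 0 ≤ M.γ)
    (hγ1 : M.γ < 1) {L : ℕ} (hL : 1 ≤ L) :
    ∃ Qf : S → A → ℝ, ∀ q : S → A → ℝ, M.avgH π L q = q ↔ q = Qf := by
  have hlip : LipschitzWith ⟨M.γ, hγ0⟩ (M.avgH π L) := by
    refine LipschitzWith.of_dist_le_mul fun q q' => ?_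
    have hD : ∀ x y, |q x y - q' x y| ≤ dist q q' := fun x y =>
      (dist_le_pi_dist (q x) (q' x) y).trans (dist_le_pi_dist q q' x)
    have h0 : 0 ≤ M.γ * dist q q' := mul_nonneg hγ0 dist_nonneg
    exact (dist_pi_le_iff h0).2 fun x => (dist_pi_le_iff h0).2 fun y =>
      M.abs_avgH_sub_le π hγ0 hγ1.le hL hD x y
  have hc : ContractingWith ⟨M.γ, hγ0⟩ (M.avgH π L) := ⟨by exact_mod_cast hγ1, hlip⟩
  exact ⟨hc.fixedPoint, fun q => ⟨fun h => hc.fixedPoint_unique h, fun h =>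
    h ▸ hc.fixedPoint_isFixedPt⟩⟩

theorem MDP.tdTarget_sub_avgH (M : MDP S A) (π : S → PMF A) (L : ℕ) (s : ℕ → S) (a : ℕ → A)
    (r : ℕ → ℝ) (q : S → A → ℝ) (t : ℕ) :
    tdTarget M.γ L s r q t - M.avgH π L q (s t) (a t) =
      (1 / (L : ℝ)) * ∑ l ∈ Finset.Icc 1 L, (∑ i ∈ Finset.Icc 1 l, M.γ ^ (i - 1) *
        (r (t + i) -
          (M.pairMatrix π ^ (i - 1)).mulVec (fun z => M.meanReward z.1 z.2) (s t, a t)) +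
        M.γ ^ l * (maxQ q (s (t + l)) -
          (M.pairMatrix π ^ l).mulVec (fun z => maxQ q z.1) (s t, a t))) := by
  rw [tdTarget, avgH, ← mul_sub, ← Finset.sum_sub_distrib]
  congr 1
  refine Finset.sum_congr rfl fun l _ => ?_
  simp only [H_eq, accReward_eq, mul_sub, Finset.sum_sub_distrib]
  ring

end Operators

/-! ### Convergence of the noise series for adapted iterates -/

/-- The partial sums of `f` converge (possibly conditionally). -/
def SeriesConverges (f : ℕ → ℝ) : Prop :=
  ∃ l, Tendsto (fun n => ∑ k ∈ Finset.range n, f k) atTop (𝓝 l)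

namespace SeriesConverges

theorem of_summable {f : ℕ → ℝ} (h : Summable f) : SeriesConverges f :=
  ⟨_, h.hasSum.tendsto_sum_nat⟩

theorem add {f g : ℕ → ℝ} (hf : SeriesConverges f) (hg : SeriesConverges g) :
    SeriesConverges fun n => f n + g n := by
  obtain ⟨l, hl⟩ := hf
  obtain ⟨l', hl'⟩ := hg
  exact ⟨l + l', by simpa only [Finset.sum_add_distrib] using hl.add hl'⟩

theorem const_mul {f : ℕ → ℝ} (hf : SeriesConverges f) (c : ℝ) :
    SeriesConverges fun n => c * f n := by
  obtain ⟨l, hl⟩ := hf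
  exact ⟨c * l, by simpa only [Finset.mul_sum] using hl.const_mul c⟩

theorem sum {ι : Type*} {I : Finset ι} {f : ι → ℕ → ℝ} (hf : ∀ i ∈ I, SeriesConverges (f i)) :
    SeriesConverges fun n => ∑ i ∈ I, f i n := by
  choose! l hl using hf
  refine ⟨∑ i ∈ I, l i, ?_⟩
  simp_rw [Finset.sum_comm (s := Finset.range _)]
  exact tendsto_finsetSum _ hl

end SeriesConverges

theorem ae_seriesConverges_finsetSum {Ω ι : Type*} {mΩ : MeasurableSpace Ω} {μ : Measure Ω}
    {I : Finset ι} {f : ι → ℕ → Ω → ℝ}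
    (hf : ∀ i ∈ I, ∀ᵐ ω ∂μ, SeriesConverges fun n => f i n ω) :
    ∀ᵐ ω ∂μ, SeriesConverges fun n => ∑ i ∈ I, f i n ω := by
  filter_upwards [(I.eventually_all).2 hf] with ω hω using SeriesConverges.sum hω

theorem summable_sq_of_abs_le {f g : ℕ → ℝ} {K : ℝ} (hg : Summable fun n => g n ^ 2)
    (h : ∀ n, |f n| ≤ K * g n) : Summable fun n => f n ^ 2 := by
  refine Summable.of_nonneg_of_le (fun _ => sq_nonneg _) (fun n => ?_) (hg.mul_left (K ^ 2))
  rw [← mul_pow, ← sq_abs]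
  exact pow_le_pow_left₀ (abs_nonneg _) (h n) 2

/-- The filtration started at time `l`. -/
def delayed {Ω : Type*} {mΩ : MeasurableSpace Ω} (ℱ : Filtration ℕ mΩ) (l : ℕ) :
    Filtration ℕ mΩ where
  seq n := ℱ (l + n)
  mono' _ _ h := ℱ.mono (Nat.add_le_add_left h l)
  le' n := ℱ.le (l + n)

section Trajectory

variable {S A : Type*} [Fintype S] [Fintype A] [MeasurableSpace S] [MeasurableSingletonClass S]
  [MeasurableSpace A] [MeasurableSingletonClass A] [DecidableEq S] [DecidableEq A]
  {Ω : Type*} {mΩ : MeasurableSpace Ω} {μ : Measure Ω} [IsProbabilityMeasure μ]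
  {ℱ : Filtration ℕ mΩ} {M : MDP S A} {π : S → PMF A}
  {s : ℕ → Ω → S} {a : ℕ → Ω → A} {r : ℕ → Ω → ℝ} {α : ℕ → Ω → ℝ}

/-- Telescoping: g(x_{t+l+1}) - (P^{l+1} g)(x_t) is the one-step difference g(x_{t+l+1}) - (P
g)(x_{t+l}) plus the l-step difference for P g. The former is a martingale difference for the
filtration delayed by l. Letting g be random, adapted and dominated by α absorbs the step size and
makes the coefficients square summable. -/
theorem IsTrajectory.ae_seriesConverges_transition (h : IsTrajectory M π μ ℱ s a r)
    (hα_sq : ∀ᵐ ω ∂μ, Summable fun t => α t ω ^ 2) {K : ℝ} (l : ℕ) {g : ℕ → Ω → S × A → ℝ}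
    (hg : ∀ t z, Measurable[ℱ t] fun ω => g t ω z)
    (hgK : ∀ᵐ ω ∂μ, ∀ t z, |g t ω z| ≤ K * α t ω) :
    ∀ᵐ ω ∂μ, SeriesConverges fun t => g t ω (s (t + l) ω, a (t + l) ω) -
      (M.pairMatrix π ^ l).mulVec (g t ω) (s t ω, a t ω) := by
  have hP := M.pairMatrix_mem_rowStochastic π
  induction l generalizing g with
  | zero => exact Eventually.of_forall fun ω => ⟨0, by simp⟩
  | succ l ih =>
    have hrest := ih (g := fun t ω => (M.pairMatrix π).mulVec (g t ω))
      (fun t z => Finset.measurable_fun_sum _ fun z' _ => (hg t z').const_mul _) (by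
        filter_upwards [hgK] with ω hω t z
        exact abs_mulVec_le_of_mem_rowStochastic hP (hω t) z)
    -- Expanding over the finitely many next pairs z separates the predictable coefficients from the
    -- centred indicators.
    have hstep : ∀ᵐ ω ∂μ, SeriesConverges fun t => ∑ z, g t ω z *
        ((if (s (l + t + 1) ω, a (l + t + 1) ω) = z then 1 else 0) -
          M.pairMatrix π (s (l + t) ω, a (l + t) ω) z) := by
      refine ae_seriesConverges_finsetSum fun z _ => ?_
      refine ae_tendsto_martingale_transform (𝒢 := delayed ℱ l) (C := 1)
        (c := fun t ω => g t ω z) (fun t => (hg t z).mono (ℱ.mono (Nat.le_add_left t l)) le_rfl)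
        (fun t => ?_) (fun t => Eventually.of_forall fun ω => ?_)
        (fun t => h.condExp_transition (l + t) z) ?_
      · exact (h.measurable_comp (fun x => if x = z then (1 : ℝ) else 0) (l + t + 1)).sub
          ((h.measurable_comp (fun x => M.pairMatrix π x z) (l + t)).mono
            (ℱ.mono (Nat.le_succ _)) le_rfl)
      · have h0 := Matrix.nonneg_of_mem_rowStochastic hP (i := (s (l + t) ω, a (l + t) ω)) (j := z)
        have h1 := Matrix.le_one_of_mem_rowStochastic hP (i := (s (l + t) ω, a (l + t) ω)) (j := z)
        split_ifs <;> exact abs_le.2 ⟨by linarith, by linarith⟩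
      · filter_upwards [hα_sq, hgK] with ω h1 h2
        exact summable_sq_of_abs_le h1 fun n => h2 n z
    filter_upwards [hrest, hstep] with ω h1 h2
    convert h2.add h1 using 2 with t
    rw [pow_succ, ← Matrix.mulVec_mulVec, ← add_assoc, Nat.add_comm t l]
    simp only [mul_sub, Finset.sum_sub_distrib, mul_ite, mul_one, mul_zero, Finset.sum_ite_eq,
      Finset.mem_univ, if_true]
    have : (M.pairMatrix π).mulVec (g t ω) (s (l + t) ω, a (l + t) ω) =
        ∑ z, g t ω z * M.pairMatrix π (s (l + t) ω, a (l + t) ω) z :=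
      Finset.sum_congr rfl fun z _ => mul_comm _ _
    rw [this]
    ring

/-- The reward noise is r (t + i + 1) minus its conditional mean at time t + i, a martingale
difference, plus the i-step transition noise of `meanReward`. -/
theorem IsTrajectory.ae_seriesConverges_reward (h : IsTrajectory M π μ ℱ s a r)
    (hM : M.BoundedRewards) (hα_sq : ∀ᵐ ω ∂μ, Summable fun t => α t ω ^ 2) {K : ℝ} (i : ℕ)
    {c : ℕ → Ω → ℝ} (hc : ∀ t, Measurable[ℱ t] (c t))
    (hcK : ∀ᵐ ω ∂μ, ∀ t, |c t ω| ≤ K * α t ω) :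
    ∀ᵐ ω ∂μ, SeriesConverges fun t => c t ω * (r (t + i + 1) ω -
      (M.pairMatrix π ^ i).mulVec (fun z => M.meanReward z.1 z.2) (s t ω, a t ω)) := by
  obtain ⟨R, hR⟩ := hM
  obtain ⟨B, hB⟩ := (Set.finite_range fun x : S × A => |M.meanReward x.1 x.2|).bddAbove
  replace hB : ∀ x y, |M.meanReward x y| ≤ B := fun x y => hB ⟨(x, y), rfl⟩
  have h1 := h.ae_seriesConverges_transition hα_sq (K := K * B) i
    (g := fun t ω z => c t ω * M.meanReward z.1 z.2) (fun t z => (hc t).mul_const _) (by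
      filter_upwards [hcK] with ω hω t z
      rw [abs_mul, mul_right_comm]
      exact mul_le_mul (hω t) (hB _ _) (abs_nonneg _) ((abs_nonneg _).trans (hω t)))
  have h2 : ∀ᵐ ω ∂μ, SeriesConverges fun t =>
      c t ω * (r (i + t + 1) ω - M.meanReward (s (i + t) ω) (a (i + t) ω)) := by
    refine ae_tendsto_martingale_transform (𝒢 := delayed ℱ i) (C := R + B)
      (c := c) (fun t => (hc t).mono (ℱ.mono (Nat.le_add_left t i)) le_rfl)
      (fun t => ?_) (fun t => ?_) (fun t => h.condExp_reward hR (i + t)) ?_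
    · exact (h.reward_meas (i + t + 1)).sub
        ((h.measurable_comp (fun x => M.meanReward x.1 x.2) (i + t)).mono
          (ℱ.mono (Nat.le_succ _)) le_rfl)
    · filter_upwards [h.ae_abs_reward_le hR] with ω hω
      exact (abs_sub _ _).trans (add_le_add (hω _) (hB _ _))
    · filter_upwards [hα_sq, hcK] with ω h1 h2
      exact summable_sq_of_abs_le h1 h2
  filter_upwards [h1, h2] with ω h1 h2
  convert h2.add h1 using 2 with t
  have : (M.pairMatrix π ^ i).mulVec (fun z => c t ω * M.meanReward z.1 z.2) (s t ω, a t ω) =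
      c t ω * (M.pairMatrix π ^ i).mulVec (fun z => M.meanReward z.1 z.2) (s t ω, a t ω) :=
    congrFun (Matrix.mulVec_smul _ (c t ω) _) _
  rw [this, Nat.add_comm t i]
  ring

variable [Nonempty A]

theorem IsTrajectory.ae_seriesConverges_noise (h : IsTrajectory M π μ ℱ s a r)
    (hM : M.BoundedRewards) (hα_sq : ∀ᵐ ω ∂μ, Summable fun t => α t ω ^ 2) {B : ℝ} (L : ℕ)
    {c : ℕ → Ω → ℝ} (hc : ∀ t, Measurable[ℱ t] (c t))
    (hcα : ∀ᵐ ω ∂μ, ∀ t, |c t ω| ≤ α t ω) {q : ℕ → Ω → S → A → ℝ}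
    (hq : ∀ t x y, Measurable[ℱ t] fun ω => q t ω x y)
    (hqB : ∀ᵐ ω ∂μ, ∀ t x y, |q t ω x y| ≤ B) :
    ∀ᵐ ω ∂μ, SeriesConverges fun t => c t ω *
      (tdTarget M.γ L (fun n => s n ω) (fun n => r n ω) (q t ω) t -
        M.avgH π L (q t ω) (s t ω) (a t ω)) := by
  have hrew : ∀ l, ∀ᵐ ω ∂μ, SeriesConverges fun t => ∑ i ∈ Finset.Icc 1 l, M.γ ^ (i - 1) *
      (c t ω * (r (t + i) ω - (M.pairMatrix π ^ (i - 1)).mulVec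
        (fun z => M.meanReward z.1 z.2) (s t ω, a t ω))) := by
    refine fun l => ae_seriesConverges_finsetSum fun i hi => ?_
    obtain ⟨j, rfl⟩ : ∃ j, i = j + 1 := ⟨i - 1, by have := (Finset.mem_Icc.1 hi).1; omega⟩
    filter_upwards [h.ae_seriesConverges_reward hM hα_sq (K := 1) j hc (by simpa using hcα)]
      with ω hω
    exact hω.const_mul _
  have hmax : ∀ l, ∀ᵐ ω ∂μ, SeriesConverges fun t => c t ω * maxQ (q t ω) (s (t + l) ω) -
      (M.pairMatrix π ^ l).mulVec (fun z => c t ω * maxQ (q t ω) z.1) (s t ω, a t ω) := by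
    refine fun l => h.ae_seriesConverges_transition hα_sq (K := B) l
      (g := fun t ω z => c t ω * maxQ (q t ω) z.1) (fun t z => (hc t).mul ?_) ?_
    · exact measurable_maxQ fun b => hq t z.1 b
    · filter_upwards [hcα, hqB] with ω h1 h2 t z
      rw [abs_mul, mul_comm]
      exact mul_le_mul (abs_maxQ_le (h2 t) _) (h1 t) (abs_nonneg _)
        ((abs_nonneg _).trans (abs_maxQ_le (h2 t) z.1))
  filter_upwards [ae_all_iff.2 hrew, ae_all_iff.2 hmax] with ω h1 h2
  have h3 := (SeriesConverges.sum (I := Finset.Icc 1 L)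
    fun l _ => (h1 l).add ((h2 l).const_mul (M.γ ^ l))).const_mul (1 / (L : ℝ))
  convert h3 using 2 with t
  rw [M.tdTarget_sub_avgH π L (fun n => s n ω) (fun n => a n ω) (fun n => r n ω) (q t ω) t,
    mul_left_comm, Finset.mul_sum]
  congr 1
  refine Finset.sum_congr rfl fun l _ => ?_
  have : (M.pairMatrix π ^ l).mulVec (fun z => c t ω * maxQ (q t ω) z.1) (s t ω, a t ω) =
      c t ω * (M.pairMatrix π ^ l).mulVec (fun z => maxQ (q t ω) z.1) (s t ω, a t ω) :=
    congrFun (Matrix.mulVec_smul _ (c t ω) _) _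
  rw [this, mul_add, Finset.mul_sum]
  congr 1
  · exact Finset.sum_congr rfl fun i _ => by ring
  · ring

end Trajectory

/-! ### Pathwise analysis of the iteration -/

section Pathwise

variable {S A : Type*} [DecidableEq S] [DecidableEq A]

/-- The step size at time `t` of the entry `(x, y)`. -/
def stepSize (s : ℕ → S) (a : ℕ → A) (α : ℕ → ℝ) (x : S) (y : A) (t : ℕ) : ℝ :=
  if s t = x ∧ a t = y then α t else 0

theorem stepSize_mem_Icc {s : ℕ → S} {a : ℕ → A} {α : ℕ → ℝ}
    (hα : ∀ t, α t ∈ Set.Icc (0 : ℝ) 1) (x : S) (y : A) (t : ℕ) :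
    stepSize s a α x y t ∈ Set.Icc (0 : ℝ) 1 := by
  unfold stepSize
  split_ifs
  exacts [hα t, ⟨le_rfl, zero_le_one⟩]

variable [Fintype A] [Nonempty A]

/-- The multi-state TD iteration along the sequences `s`, `a`, `r`, `α`. -/
def IsMultiStateIteration (γ : ℝ) (L : ℕ) (s : ℕ → S) (a : ℕ → A) (r α : ℕ → ℝ)
    (q : ℕ → S → A → ℝ) : Prop :=
  ∀ t x y, q (t + 1) x y =
    if s t = x ∧ a t = y then q t x y + α t * tdError γ L s a r (q t) t else q t x y

/-- The multi-state TD iteration started at zero. -/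
noncomputable def iterationFromZero (γ : ℝ) (L : ℕ) (s : ℕ → S) (a : ℕ → A) (r α : ℕ → ℝ) :
    ℕ → S → A → ℝ
  | 0 => fun _ _ => 0
  | t + 1 => fun x y =>
    if s t = x ∧ a t = y then iterationFromZero γ L s a r α t x y +
      α t * tdError γ L s a r (iterationFromZero γ L s a r α t) t
    else iterationFromZero γ L s a r α t x y

variable {γ : ℝ} {L : ℕ} {s : ℕ → S} {a : ℕ → A} {r α : ℕ → ℝ} {q q' : ℕ → S → A → ℝ}

theorem isMultiStateIteration_iterationFromZero :
    IsMultiStateIteration γ L s a r α (iterationFromZero γ L s a r α) := fun _ _ _ => rfl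

namespace IsMultiStateIteration

theorem succ_eq (h : IsMultiStateIteration γ L s a r α q) (hL : 1 ≤ L) (t : ℕ) (x : S) (y : A) :
    q (t + 1) x y = (1 - stepSize s a α x y t) * q t x y +
      stepSize s a α x y t * tdTarget γ L s r (q t) t := by
  rw [h, stepSize]
  split_ifs with hxy
  · obtain ⟨rfl, rfl⟩ := hxy
    rw [tdError_eq hL]
    ring
  · ring

theorem abs_le (h : IsMultiStateIteration γ L s a r α q) (hL : 1 ≤ L)
    (hα : ∀ t, α t ∈ Set.Icc (0 : ℝ) 1) (hγ0 : 0 ≤ γ) {R B : ℝ} (hr : ∀ t, |r (t + 1)| ≤ R)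
    (hB : R + γ * B = B) (h0 : ∀ x y, |q 0 x y| ≤ B) (t : ℕ) (x : S) (y : A) :
    |q t x y| ≤ B := by
  induction t generalizing x y with
  | zero => exact h0 x y
  | succ t ih =>
    obtain ⟨hc0, hc1⟩ := stepSize_mem_Icc (s := s) (a := a) hα x y t
    rw [h.succ_eq hL]
    refine (abs_add_le _ _).trans ?_
    rw [abs_mul, abs_mul, abs_of_nonneg hc0, abs_of_nonneg (sub_nonneg.2 hc1)]
    have h1 := mul_le_mul_of_nonneg_left (ih x y) (sub_nonneg.2 hc1)
    have h2 := mul_le_mul_of_nonneg_left (abs_tdTarget_le hγ0 hL s hr hB ih t) hc0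
    linarith

/-- One update moves an entry by at most 2 B α; this prices the later replacement of an iterate by a
lagged one. -/
theorem abs_add_sub_le (h : IsMultiStateIteration γ L s a r α q) (hL : 1 ≤ L)
    (hα : ∀ t, α t ∈ Set.Icc (0 : ℝ) 1) {B : ℝ} (hq : ∀ t x y, |q t x y| ≤ B)
    (htd : ∀ t, |tdTarget γ L s r (q t) t| ≤ B) (t n : ℕ) (x : S) (y : A) :
    |q (t + n) x y - q t x y| ≤ 2 * B * ∑ j ∈ Finset.range n, α (t + j) := by
  induction n with
  | zero => simp
  | succ n ih =>
    have h1 : |q (t + n + 1) x y - q (t + n) x y| ≤ 2 * B * α (t + n) := by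
      have hB : |tdTarget γ L s r (q (t + n)) (t + n) - q (t + n) x y| ≤ 2 * B :=
        (abs_sub _ _).trans (by linarith [htd (t + n), hq (t + n) x y])
      have heq : q (t + n + 1) x y - q (t + n) x y = stepSize s a α x y (t + n) *
          (tdTarget γ L s r (q (t + n)) (t + n) - q (t + n) x y) := by
        rw [h.succ_eq hL]
        ring
      have hc : |stepSize s a α x y (t + n)| ≤ α (t + n) := by
        unfold stepSize
        split_ifs
        · exact (abs_of_nonneg (hα _).1).le
        · simpa using (hα _).1
      rw [heq, abs_mul, mul_comm]
      exact mul_le_mul hB hc (abs_nonneg _) ((abs_nonneg _).trans hB)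
    rw [Finset.sum_range_succ, mul_add]
    refine (abs_sub_le _ (q (t + n) x y) _).trans ?_
    rw [← add_assoc]
    linarith

variable [Fintype S]

/-- Both iterations see the same samples, so the noise cancels and only the contraction of the
sampled target remains. Nothing is needed of the initial values. -/
theorem tendsto_sub (h : IsMultiStateIteration γ L s a r α q)
    (h' : IsMultiStateIteration γ L s a r α q') (hL : 1 ≤ L) (hγ0 : 0 ≤ γ) (hγ1 : γ < 1)
    (hα : ∀ t, α t ∈ Set.Icc (0 : ℝ) 1)
    (hsum : ∀ x y, Tendsto (fun n => ∑ t ∈ Finset.range n, stepSize s a α x y t) atTop atTop)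
    (x : S) (y : A) : Tendsto (fun t => q t x y - q' t x y) atTop (𝓝 0) := by
  have key := tendsto_zero_of_asynchronous_contraction (X := S × A)
    (y := fun t z => |q t z.1 z.2 - q' t z.1 z.2|)
    (a := fun t z => stepSize s a α z.1 z.2 t) (ε := fun _ => 0) hγ0 hγ1
    (fun t z => stepSize_mem_Icc hα z.1 z.2 t) (fun z => hsum z.1 z.2) (fun _ _ => abs_nonneg _)
    tendsto_const_nhds (by
      intro t z D hD
      obtain ⟨hc0, hc1⟩ := stepSize_mem_Icc (s := s) (a := a) hα z.1 z.2 t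
      have heq : q (t + 1) z.1 z.2 - q' (t + 1) z.1 z.2 =
          (1 - stepSize s a α z.1 z.2 t) * (q t z.1 z.2 - q' t z.1 z.2) +
          stepSize s a α z.1 z.2 t * (tdTarget γ L s r (q t) t - tdTarget γ L s r (q' t) t) := by
        rw [h.succ_eq hL, h'.succ_eq hL]
        ring
      simp only [heq, add_zero]
      refine (abs_add_le _ _).trans ?_
      rw [abs_mul, abs_mul, abs_of_nonneg hc0, abs_of_nonneg (sub_nonneg.2 hc1)]
      gcongr
      exact abs_tdTarget_sub_le hγ0 hγ1.le hL s r (fun x y => hD (x, y)) t) (x, y)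
  exact (tendsto_zero_iff_abs_tendsto_zero _).2 key

theorem tendsto_fixedPoint {M : MDP S A} {π : S → PMF A}
    (h : IsMultiStateIteration M.γ L s a r α q) (hL : 1 ≤ L) (hγ0 : 0 ≤ M.γ) (hγ1 : M.γ < 1)
    (hα : ∀ t, α t ∈ Set.Icc (0 : ℝ) 1)
    (hsum : ∀ x y, Tendsto (fun n => ∑ t ∈ Finset.range n, stepSize s a α x y t) atTop atTop)
    (hnoise : ∀ x y, SeriesConverges fun t => stepSize s a α x y t *
      (tdTarget M.γ L s r (q t) t - M.avgH π L (q t) (s t) (a t)))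
    {Qf : S → A → ℝ} (hQf : M.avgH π L Qf = Qf) (x : S) (y : A) :
    Tendsto (fun t => q t x y) atTop (𝓝 (Qf x y)) := by
  set c : ℕ → S × A → ℝ := fun t z => stepSize s a α z.1 z.2 t with hc
  have hc01 : ∀ t z, c t z ∈ Set.Icc (0 : ℝ) 1 := fun t z => stepSize_mem_Icc hα z.1 z.2 t
  set w : ℕ → ℝ := fun t => tdTarget M.γ L s r (q t) t - M.avgH π L (q t) (s t) (a t) with hw
  have hex : ∀ z : S × A, ∃ W : ℕ → ℝ, ∀ t, W (t + 1) = (1 - c t z) * W t + c t z * w t :=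
    fun z => ⟨fun n => Nat.rec 0 (fun t W => (1 - c t z) * W + c t z * w t) n, fun _ => rfl⟩
  choose W hW using hex
  have hW0 : ∀ z, Tendsto (W z) atTop (𝓝 0) := fun z =>
    tendsto_zero_of_averaging (fun t => hc01 t z) (hsum z.1 z.2) (hW z) (hnoise z.1 z.2)
  have hε : Tendsto (fun t => M.γ * ∑ z, |W z t|) atTop (𝓝 0) := by
    have := tendsto_finsetSum Finset.univ fun z (_ : z ∈ Finset.univ) => (hW0 z).abs
    simpa using this.const_mul M.γ
  have key := tendsto_zero_of_asynchronous_contraction (X := S × A)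
    (y := fun t z => |q t z.1 z.2 - Qf z.1 z.2 - W z t|) (a := c) hγ0 hγ1 hc01
    (fun z => hsum z.1 z.2) (fun _ _ => abs_nonneg _) hε (by
      intro t z D hD
      -- Contracting this bound gives γ D plus the perturbation γ Σ |W z t|.
      have hdist : ∀ x y, |q t x y - Qf x y| ≤ D + ∑ z, |W z t| := by
        intro x y
        have h1 := Finset.single_le_sum (f := fun z => |W z t|) (fun z _ => abs_nonneg _)
          (Finset.mem_univ (x, y))
        have h2 := abs_add_le (q t x y - Qf x y - W (x, y) t) (W (x, y) t)
        rw [sub_add_cancel] at h2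
        linarith [hD (x, y)]
      have hcontr := M.abs_avgH_sub_le π hγ0 hγ1.le hL hdist z.1 z.2
      rw [hQf] at hcontr
      have heq : q (t + 1) z.1 z.2 - Qf z.1 z.2 - W z (t + 1) =
          (1 - c t z) * (q t z.1 z.2 - Qf z.1 z.2 - W z t) +
          c t z * (M.avgH π L (q t) z.1 z.2 - Qf z.1 z.2) := by
        rw [h.succ_eq hL, hW]
        -- w t is centred at the visited pair; at any other entry the step size vanishes and the
        -- mismatch is harmless.
        by_cases hz : s t = z.1 ∧ a t = z.2
        · simp only [hw, hz.1, hz.2, hc]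
          ring
        · have : stepSize s a α z.1 z.2 t = 0 := if_neg hz
          simp only [hc, this]
          ring
      have hcz := hc01 t z
      rw [heq]
      refine (abs_add_le _ _).trans ?_
      rw [abs_mul, abs_mul, abs_of_nonneg hcz.1, abs_of_nonneg (sub_nonneg.2 hcz.2), ← mul_add]
      have := hcz.1
      gcongr) (x, y)
  have h1 := ((tendsto_zero_iff_abs_tendsto_zero _).2 key).add (hW0 (x, y))
  simpa using h1.add_const (Qf x y)

end IsMultiStateIteration

end Pathwise

/-! ### Removing the look-ahead by a lag of L steps -/

theorem summable_mul_sum_shift {α : ℕ → ℝ} (hα : ∀ t, 0 ≤ α t)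
    (hsq : Summable fun t => α t ^ 2) (L : ℕ) :
    Summable fun n => α (n + L) * ∑ j ∈ Finset.range L, α (n + j) := by
  simp_rw [Finset.mul_sum]
  refine summable_sum fun j _ => ?_
  refine Summable.of_nonneg_of_le (fun n => mul_nonneg (hα _) (hα _)) (fun n => ?_)
    (((summable_nat_add_iff L).2 hsq).add ((summable_nat_add_iff j).2 hsq))
  nlinarith [sq_nonneg (α (n + L) - α (n + j)), sq_nonneg (α (n + L)), sq_nonneg (α (n + j))]

section Trajectory

variable {S A : Type*} [DecidableEq S] [DecidableEq A]
  [MeasurableSpace S] [MeasurableSingletonClass S]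
  [MeasurableSpace A] [MeasurableSingletonClass A]
  {Ω : Type*} {mΩ : MeasurableSpace Ω} {μ : Measure Ω}
  {ℱ : Filtration ℕ mΩ} {M : MDP S A} {π : S → PMF A}
  {s : ℕ → Ω → S} {a : ℕ → Ω → A} {r : ℕ → Ω → ℝ} {α : ℕ → Ω → ℝ}

theorem IsTrajectory.measurable_stepSize (h : IsTrajectory M π μ ℱ s a r)
    (hα : ∀ t, Measurable[ℱ t] (α t)) (t : ℕ) (x : S) (y : A) :
    Measurable[ℱ t] fun ω =>
      stepSize (fun n => s n ω) (fun n => a n ω) (fun n => α n ω) x y t :=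
  Measurable.ite (((h.state_meas t) (measurableSet_singleton x)).inter
    ((h.action_meas t) (measurableSet_singleton y))) (hα t) measurable_const

variable [Fintype S] [Fintype A] [Nonempty A]

theorem IsTrajectory.measurable_iterationFromZero (h : IsTrajectory M π μ ℱ s a r)
    (hα : ∀ t, Measurable[ℱ t] (α t)) {L : ℕ} (hL : 1 ≤ L) (γ : ℝ) (t : ℕ) (x : S) (y : A) :
    Measurable[ℱ (t + L)] fun ω => iterationFromZero γ L (fun n => s n ω) (fun n => a n ω)
      (fun n => r n ω) (fun n => α n ω) t x y := by
  induction t generalizing x y with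
  | zero => exact measurable_const
  | succ t ih =>
    simp only [isMultiStateIteration_iterationFromZero.succ_eq hL]
    have hmono : ∀ {i}, i ≤ t + L → ℱ i ≤ ℱ (t + 1 + L) := fun hi => ℱ.mono (by omega)
    have ih' := fun x y => (ih x y).mono (hmono le_rfl) le_rfl
    have hc := (h.measurable_stepSize hα t x y).mono (hmono (Nat.le_add_right t L)) le_rfl
    refine ((measurable_const.sub hc).mul (ih' x y)).add (hc.mul ?_)
    refine (Finset.measurable_fun_sum _ fun l hl => ?_).const_mul _
    have hl' := Finset.mem_Icc.1 hl
    refine (Finset.measurable_fun_sum _ fun i hi => ?_).add (Measurable.const_mul ?_ _)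
    · have hi' := Finset.mem_Icc.1 hi
      exact ((h.reward_meas (t + i)).mono (hmono (by omega)) le_rfl).const_mul _
    · have hs := (h.state_meas (t + l)).mono (hmono (by omega)) le_rfl
      -- Evaluation at a random state becomes a finite sum over fixed states, whose terms are
      -- measurable.
      have hsum : ∀ ω (q : S → A → ℝ), maxQ q (s (t + l) ω) =
          ∑ z, if s (t + l) ω = z then maxQ q z else 0 := fun ω q => by simp
      simp only [hsum]
      exact Finset.measurable_fun_sum _ fun z _ => Measurable.ite
        (hs (measurableSet_singleton z)) (measurable_maxQ fun b => ih' z b)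
        measurable_const

/-- The noise of q t is the noise of q (t - L), which is adapted, plus a difference that is
absolutely summable. -/
theorem IsTrajectory.ae_seriesConverges_iterationFromZero [IsProbabilityMeasure μ]
    (h : IsTrajectory M π μ ℱ s a r) (hγ0 : 0 ≤ M.γ) (hγ1 : M.γ < 1) (hM : M.BoundedRewards)
    (hα_meas : ∀ t, Measurable[ℱ t] (α t)) (hα01 : ∀ t ω, α t ω ∈ Set.Icc (0 : ℝ) 1)
    (hα_sq : ∀ᵐ ω ∂μ, Summable fun t => α t ω ^ 2) {L : ℕ} (hL : 1 ≤ L) (x : S) (y : A) :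
    ∀ᵐ ω ∂μ, SeriesConverges fun t =>
      stepSize (fun n => s n ω) (fun n => a n ω) (fun n => α n ω) x y t *
      (tdTarget M.γ L (fun n => s n ω) (fun n => r n ω) (iterationFromZero M.γ L (fun n => s n ω)
        (fun n => a n ω) (fun n => r n ω) (fun n => α n ω) t) t -
      M.avgH π L (iterationFromZero M.γ L (fun n => s n ω) (fun n => a n ω) (fun n => r n ω)
        (fun n => α n ω) t) (s t ω) (a t ω)) := by
  obtain ⟨R, hR⟩ := hM
  have hr := h.ae_abs_reward_le hR
  set c : ℕ → Ω → ℝ := fun t ω =>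
    stepSize (fun n => s n ω) (fun n => a n ω) (fun n => α n ω) x y t with hc
  set q : ℕ → Ω → S → A → ℝ := fun t ω => iterationFromZero M.γ L (fun n => s n ω)
    (fun n => a n ω) (fun n => r n ω) (fun n => α n ω) t with hq
  have hiter : ∀ ω, IsMultiStateIteration M.γ L (fun n => s n ω) (fun n => a n ω)
      (fun n => r n ω) (fun n => α n ω) fun t => q t ω :=
    fun _ => isMultiStateIteration_iterationFromZero
  have hcα : ∀ t ω, |c t ω| ≤ α t ω := by
    intro t ω
    simp only [hc, stepSize]
    split_ifs
    · exact (abs_of_nonneg (hα01 t ω).1).le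
    · simpa using (hα01 t ω).1
  set B := R / (1 - M.γ) with hBdef
  have hB : R + M.γ * B = B := by
    have : 1 - M.γ ≠ 0 := by linarith
    rw [hBdef]
    field_simp
    ring
  have hqB : ∀ᵐ ω ∂μ, ∀ t x y, |q t ω x y| ≤ B := by
    filter_upwards [hr] with ω hω
    refine (hiter ω).abs_le hL (fun t => hα01 t ω) hγ0 hω hB fun x y => ?_
    have hR0 : 0 ≤ R := (abs_nonneg _).trans (hω 0)
    simp only [hq, iterationFromZero, abs_zero]
    exact div_nonneg hR0 (by linarith)
  -- For t ≤ L the truncated subtraction gives q 0 = 0, which is constant.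
  have hlag : ∀ t x y, Measurable[ℱ t] fun ω => q (t - L) ω x y := by
    intro t x y
    rcases le_total L t with hLt | hLt
    · have := h.measurable_iterationFromZero hα_meas hL M.γ (t - L) x y
      rwa [Nat.sub_add_cancel hLt] at this
    · simp only [Nat.sub_eq_zero_of_le hLt, hq, iterationFromZero]
      exact measurable_const
  have hmain := h.ae_seriesConverges_noise ⟨R, hR⟩ hα_sq L
    (fun t => h.measurable_stepSize hα_meas t x y) (Eventually.of_forall fun ω t => hcα t ω)
    hlag (hqB.mono fun ω hω t => hω (t - L))
  filter_upwards [hmain, hr, hqB, hα_sq] with ω hmain hr hqB hsq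
  set T : (S → A → ℝ) → ℕ → ℝ := tdTarget M.γ L (fun n => s n ω) (fun n => r n ω) with hT
  have hdiff : Summable fun t => c t ω *
      ((T (q t ω) t - M.avgH π L (q t ω) (s t ω) (a t ω)) -
        (T (q (t - L) ω) t - M.avgH π L (q (t - L) ω) (s t ω) (a t ω))) := by
    -- Dropping the first L terms makes the lag exact. In 4 γ B, a factor 2 B comes from the drift
    -- of q, γ from the contraction, and 2 from target and operator both moving.
    refine (summable_nat_add_iff L).1 (Summable.of_norm_bounded
      ((summable_mul_sum_shift (fun t => (hα01 t ω).1) hsq L).mul_left (4 * M.γ * B)) fun n => ?_)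
    have hD := (hiter ω).abs_add_sub_le hL (fun t => hα01 t ω) hqB
      (fun t => abs_tdTarget_le hγ0 hL _ hr hB (hqB t) t) n L
    have h1 := abs_tdTarget_sub_le hγ0 hγ1.le hL (fun n => s n ω) (fun n => r n ω) hD (n + L)
    have h2 := M.abs_avgH_sub_le π hγ0 hγ1.le hL hD (s (n + L) ω) (a (n + L) ω)
    rw [Nat.add_sub_cancel, Real.norm_eq_abs, abs_mul, sub_sub_sub_comm]
    calc _ ≤ α (n + L) ω * (2 * (M.γ * (2 * B * ∑ j ∈ Finset.range L, α (n + j) ω))) :=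
          mul_le_mul (hcα _ _) ((abs_sub _ _).trans (by linarith)) (abs_nonneg _) (hα01 _ _).1
      _ = _ := by ring
  convert hmain.add (SeriesConverges.of_summable hdiff) using 2 with t
  ring

end Trajectory

end MSTD

theorem theorem1
    {S A : Type*} [Fintype S] [Fintype A] [DecidableEq S] [DecidableEq A] [Nonempty A]
    [MeasurableSpace S] [MeasurableSingletonClass S]
    [MeasurableSpace A] [MeasurableSingletonClass A]
    {Ω : Type*} {mΩ : MeasurableSpace Ω} (μ : Measure Ω) [IsProbabilityMeasure μ]
    (ℱ : Filtration ℕ mΩ)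
    (M : MSTD.MDP S A) (hγ0 : 0 ≤ M.γ) (hγ1 : M.γ < 1) (hM : M.BoundedRewards)
    (π : S → PMF A)
    (s : ℕ → Ω → S) (a : ℕ → Ω → A) (r : ℕ → Ω → ℝ)
    (htraj : MSTD.IsTrajectory M π μ ℱ s a r)
    (α : ℕ → Ω → ℝ) (hα_meas : ∀ t, Measurable[ℱ t] (α t))
    (hα01 : ∀ t ω, α t ω ∈ Set.Icc (0 : ℝ) 1)
    (hα_sum : ∀ x y, ∀ᵐ ω ∂μ, Tendsto
      (fun n => ∑ t ∈ Finset.range n, if s t ω = x ∧ a t ω = y then α t ω else 0) atTop atTop)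
    (hα_sq : ∀ᵐ ω ∂μ, Summable fun t => α t ω ^ 2)
    (L : ℕ) (hL : 1 ≤ L)
    (Q : ℕ → Ω → S → A → ℝ)
    (hQ : ∀ t ω x y, Q (t + 1) ω x y =
      if s t ω = x ∧ a t ω = y then
        Q t ω x y + α t ω *
          MSTD.tdError M.γ L (fun n => s n ω) (fun n => a n ω) (fun n => r n ω) (Q t ω) t
      else Q t ω x y) :
    ∃ Qf : S → A → ℝ,
      (∀ q : S → A → ℝ, M.avgH π L q = q ↔ q = Qf) ∧
      (∀ q : S → A → ℝ, (∀ l ∈ Finset.Icc 1 L, M.H π l q = q) → q = Qf) ∧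
      ∀ᵐ ω ∂μ, ∀ x y, Tendsto (fun t => Q t ω x y) atTop (𝓝 (Qf x y)) := by

  obtain ⟨Qf, hQf⟩ := M.exists_unique_fixedPoint_avgH π hγ0 hγ1 hL
  refine ⟨Qf, hQf, fun q hq => (hQf q).1 ?_, ?_⟩
  · ext x y
    have hL0 : (L : ℝ) ≠ 0 := by exact_mod_cast (by omega : L ≠ 0)
    have hsum : ∑ l ∈ Finset.Icc 1 L, M.H π l q x y = ∑ _l ∈ Finset.Icc 1 L, q x y :=
      Finset.sum_congr rfl fun l hl => by rw [hq l hl]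
    simp [MSTD.MDP.avgH, hsum, hL0]
  · have hnoise := ae_all_iff.2 fun x => ae_all_iff.2 fun y =>
      htraj.ae_seriesConverges_iterationFromZero hγ0 hγ1 hM hα_meas hα01 hα_sq hL x y
    filter_upwards [hnoise, ae_all_iff.2 fun x => ae_all_iff.2 (hα_sum x)] with ω hnoise hsum x y
    have hα := fun t => hα01 t ω
    have hzero := MSTD.isMultiStateIteration_iterationFromZero (γ := M.γ) (L := L)
      (s := fun n => s n ω) (a := fun n => a n ω) (r := fun n => r n ω) (α := fun n => α n ω)
    have h1 := hzero.tendsto_fixedPoint hL hγ0 hγ1 hα hsum hnoise ((hQf Qf).2 rfl) x y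
    have hiter : MSTD.IsMultiStateIteration M.γ L (fun n => s n ω) (fun n => a n ω)
        (fun n => r n ω) (fun n => α n ω) fun t => Q t ω := fun t => hQ t ω
    -- The limit is transferred from the zero start to the given Q 0, path by path.
    have h2 := hiter.tendsto_sub hzero hL hγ0 hγ1 hα hsum x y
    simpa using h2.add h1
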